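/- Let $g:\mathbb R\to[0,\infty)$ be a probability density that is real analytic, even, and unimodal (non-decreasing up to some point and non-increasing after it). Let $\hat g(\eta)=\int_{\mathbb R}e^{i\eta\omega}g(\omega)\,d\omega$ be continuous with $\lim_{\eta\to\infty}|\hat g(\eta)|e^{a\eta}=0$ for some $0<a<1$. Let $I=[0,1]$, and let $\mathcal Y$ be the space of continuous $\phi:\mathbb R^2\to\mathbb C$ with $\|\phi\|=\sup_{\xi,\eta}\min\{e^{\xi},1\}|\phi(\xi,\eta)|<\infty$. Let $\mathcal H=L^2(I;\mathcal Y)$. For $K\in\mathbb R$ let $\boldsymbol S=\boldsymbol L_1+K\boldsymbol B$ be the operator on $\mathcal H$ that governs the linearization, about the mixing state $\frac{g(\omega)}{2\pi}\delta(\psi)$, of the Vlasov equation of the second order Kuramoto model with all-to-all coupling $W\equiv1$ (damping $1$, coupling strength $K$), in Fourier variables: $$\boldsymbol L_1\phi=(\partial_\xi+\partial_\eta)\phi,\qquad (\boldsymbol B\phi)(\xi,\eta,x)=(1-e^{-\xi})\,\hat g(\eta)\int_I\phi(0,0,y)\,dy .$$ Here $\partial_\xi+\partial_\eta$ is the derivative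 in the direction $(1,1)$, and its domain is the set of $\phi\in\mathcal H$ for which it exists everywhere (for a.e. $x$) and lies in $\mathcal H$. For $\operatorname{Re}\lambda>0$ put $$G(\lambda)=\int_{\mathbb R}\Big(\frac1{\lambda-i\omega}-\frac1{\lambda+1-i\omega}\Big)g(\omega)\,d\omega .$$ Then the following hold. 1. For every $t\in\mathbb R$ the limit $G(it)=\lim_{x\to0+}G(x+it)$ exists. Put $x_0=\int_{\mathbb R}\frac{g(0)-g(\omega)}{1+\omega^2}\,d\omega$. Then $x_0>0$, $G(0)=x_0$, and the critical curve $\{G(it):t\in\mathbb R\}$ meets the positive real axis only at $x_0$. 2. Let $K_c=1/x_0$. If $K<K_c$, then $\boldsymbol S$ has no eigenvalue with positive real part. 3. If $K>K_c$, then $\boldsymbol S$ has exactly one eigenvalue $\lambda(K)$ with positive real part. It is real and algebraically simple, and $\lambda(K)\to0+$ as $K\to K_c+$. 4. At $K=K_c$ mixing undergoes a pitchfork bifurcation in the following spectral sense, i.e. one simple real eigenvalue of the linearization enters the right half-plane through $0$ (in contrast to a pair $\pm i\nu$, as in the Andronov–Hopf case). (a) $G(it)=1/K_c$ if and only if $t=0$.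 (b) The map $t\mapsto G(it)$ is differentiable at $t=0$ and its derivative there has non-zero imaginary part, so the curve crosses the real axis transversally. (c) For $K$ slightly below $K_c$ there is no eigenvalue with positive real part. (d) For $K$ slightly above $K_c$ there is exactly one, it is real and simple, and, with $\lambda(K_c):=0$, it leaves the origin with positive speed: the right derivative of $\lambda(K)$ at $K_c$ exists and is positive. -/

import Mathlib

open MeasureTheory Filter Topology

noncomputable section

namespace KuramotoInertia

/-! ### The frequency density -/

/-- `g` is a probability density on `ℝ`. -/
structure IsDensity (g : ℝ → ℝ) : Prop where
  nonneg : ∀ ω, 0 ≤ g ω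
  integrable : Integrable g
  integral_eq_one : ∫ ω, g ω = 1

/-- Unimodality: non-decreasing up to some point `m`, non-increasing from there on. -/
def IsUnimodal (g : ℝ → ℝ) : Prop :=
  ∃ m : ℝ, MonotoneOn g (Set.Iic m) ∧ AntitoneOn g (Set.Ici m)

/-- `ĝ(η) = ∫ e^{iηω} g(ω) dω`. -/
def ghat (g : ℝ → ℝ) (η : ℝ) : ℂ :=
  ∫ ω : ℝ, Complex.exp (Complex.I * η * ω) * (g ω : ℂ)

/-- `g` is real analytic, `ĝ` is continuous, and `|ĝ(η)| e^{aη} → 0` as `η → ∞` for some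
`0 < a < 1`. -/
structure DecayAssumption (g : ℝ → ℝ) : Prop where
  analytic : ∀ ω, AnalyticAt ℝ g ω
  continuous_ghat : Continuous (ghat g)
  decay : ∃ a : ℝ, 0 < a ∧ a < 1 ∧
    Tendsto (fun η : ℝ => ‖ghat g η‖ * Real.exp (a * η)) atTop (𝓝 0)

/-! ### The space `H = L²(I; Y)` -/

/-- The weight `β₂(ξ) = min {e^ξ, 1}`. -/
def weight (ξ : ℝ) : ℝ := min (Real.exp ξ) 1

lemma weight_pos (ξ : ℝ) : 0 < weight ξ := lt_min (Real.exp_pos ξ) one_pos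

lemma continuous_weight : Continuous weight := Real.continuous_exp.min continuous_const

/-- The continuous functions `φ(ξ, η)` on `ℝ²` with `sup β₂(ξ) |φ(ξ, η)| < ∞`. -/
def spaceYSubmodule : Submodule ℂ (ℝ × ℝ → ℂ) where
  carrier := {φ | Continuous φ ∧ ∃ C : ℝ, ∀ p : ℝ × ℝ, weight p.1 * ‖φ p‖ ≤ C}
  zero_mem' := ⟨continuous_const, 0, fun p => by simp⟩
  add_mem' := by
    rintro φ ψ ⟨hφ, C, hC⟩ ⟨hψ, D, hD⟩
    refine ⟨hφ.add hψ, C + D, fun p => ?_⟩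
    calc weight p.1 * ‖(φ + ψ) p‖ ≤ weight p.1 * (‖φ p‖ + ‖ψ p‖) :=
          mul_le_mul_of_nonneg_left (norm_add_le _ _) (weight_pos _).le
      _ = weight p.1 * ‖φ p‖ + weight p.1 * ‖ψ p‖ := mul_add _ _ _
      _ ≤ C + D := add_le_add (hC p) (hD p)
  smul_mem' := by
    rintro c φ ⟨hφ, C, hC⟩
    refine ⟨hφ.const_smul c, ‖c‖ * C, fun p => ?_⟩
    calc weight p.1 * ‖(c • φ) p‖ = ‖c‖ * (weight p.1 * ‖φ p‖) := by
          rw [Pi.smul_apply, norm_smul]; ring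
      _ ≤ ‖c‖ * C := mul_le_mul_of_nonneg_left (hC p) (norm_nonneg c)

/-- The Banach space `Y = Y₀⁺`; its norm, defined below, is `sup β₂(ξ) |φ(ξ, η)|`. -/
def SpaceY : Type := spaceYSubmodule

namespace SpaceY

instance : AddCommGroup SpaceY := inferInstanceAs (AddCommGroup spaceYSubmodule)

instance : Module ℂ SpaceY := inferInstanceAs (Module ℂ spaceYSubmodule)

instance : CoeFun SpaceY (fun _ => ℝ × ℝ → ℂ) := ⟨fun φ => φ.1⟩

/-- The map `φ ↦ β₂ φ` into the bounded continuous functions. -/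
def weighted : SpaceY →ₗ[ℂ] BoundedContinuousFunction (ℝ × ℝ) ℂ where
  toFun φ := BoundedContinuousFunction.ofNormedAddCommGroup
    (fun p => (weight p.1 : ℂ) * φ p)
    ((Complex.continuous_ofReal.comp (continuous_weight.comp continuous_fst)).mul φ.2.1)
    φ.2.2.choose
    (fun p => by
      rw [norm_mul, Complex.norm_real, Real.norm_of_nonneg (weight_pos _).le]
      exact φ.2.2.choose_spec p)
  map_add' φ ψ := by
    ext p
    exact mul_add (weight p.1 : ℂ) (φ p) (ψ p)
  map_smul' c φ := by
    ext p
    exact mul_left_comm (weight p.1 : ℂ) c (φ p)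

lemma weighted_apply (φ : SpaceY) (p : ℝ × ℝ) : weighted φ p = (weight p.1 : ℂ) * φ p := rfl

lemma weighted_injective : Function.Injective weighted := by
  intro φ ψ h
  apply Subtype.ext
  funext p
  have hp : (weight p.1 : ℂ) * φ p = (weight p.1 : ℂ) * ψ p := by
    rw [← weighted_apply, ← weighted_apply, h]
  exact mul_left_cancel₀ (Complex.ofReal_ne_zero.mpr (weight_pos p.1).ne') hp

instance : NormedAddCommGroup SpaceY :=
  NormedAddCommGroup.induced SpaceY (BoundedContinuousFunction (ℝ × ℝ) ℂ) weighted
    weighted_injective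

instance : NormedSpace ℂ SpaceY :=
  NormedSpace.induced ℂ SpaceY (BoundedContinuousFunction (ℝ × ℝ) ℂ) weighted

lemma norm_eq_iSup (φ : SpaceY) : ‖φ‖ = ⨆ p : ℝ × ℝ, weight p.1 * ‖φ p‖ := by
  have h : ‖φ‖ = ‖weighted φ‖ := rfl
  rw [h, BoundedContinuousFunction.norm_eq_iSup_norm]
  congr 1
  funext p
  rw [weighted_apply, norm_mul, Complex.norm_real, Real.norm_of_nonneg (weight_pos _).le]

end SpaceY

/-- Lebesgue measure on `I = [0, 1]`. -/
def volI : Measure ℝ := volume.restrict (Set.Icc 0 1)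

/-- `H = H₀⁺ = L²(I; Y)`. -/
abbrev SpaceH : Type := Lp SpaceY 2 volI

/-! ### The linearized operator `S = L₁ + K B` -/

/-- `v` lies in the domain of `L₁ = ∂_ξ + ∂_η` and `L₁ v = w`: the derivative of `v` in the
direction `(1, 1)` exists everywhere (for almost every `x`) and equals `w`. -/
def IsL1 (v w : SpaceH) : Prop :=
  ∀ᵐ x ∂volI, ∀ ξ η : ℝ, HasDerivAt (fun t : ℝ => v x (ξ + t, η + t)) (w x (ξ, η)) 0

/-- The integral operator `(𝐖 f)(x) = ∫_I W(x, y) f(y) dy`. -/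
def graphonOp (W : ℝ → ℝ → ℝ) (f : ℝ → ℂ) (x : ℝ) : ℂ :=
  ∫ y, (W x y : ℂ) * f y ∂volI

/-- `B v = w`, where `(B v)(ξ, η, x) = (1 - e^{-ξ}) ĝ(η) 𝐖[v(0, 0, ·)](x)`. -/
def IsB (W : ℝ → ℝ → ℝ) (g : ℝ → ℝ) (v w : SpaceH) : Prop :=
  ∀ᵐ x ∂volI, ∀ ξ η : ℝ,
    w x (ξ, η) = (1 - Real.exp (-ξ) : ℝ) * ghat g η * graphonOp W (fun y => v y (0, 0)) x

/-- `v` lies in the domain of `S = L₁ + K B` and `S v = w`. -/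
def IsS (W : ℝ → ℝ → ℝ) (g : ℝ → ℝ) (K : ℝ) (v w : SpaceH) : Prop :=
  ∃ w₁ w₂ : SpaceH, IsL1 v w₁ ∧ IsB W g v w₂ ∧ w = w₁ + (K : ℂ) • w₂

/-- `lam` is an eigenvalue of `S` on `H`. -/
def IsEigenvalue (W : ℝ → ℝ → ℝ) (g : ℝ → ℝ) (K : ℝ) (lam : ℂ) : Prop :=
  ∃ v : SpaceH, v ≠ 0 ∧ IsS W g K v (lam • v)

/-- `lam` is an (algebraically) simple eigenvalue of `S` on `H`: the eigenspace is a line, and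
no eigenvector `v` is of the form `v = (S - lam) w`. -/
def IsSimpleEigenvalue (W : ℝ → ℝ → ℝ) (g : ℝ → ℝ) (K : ℝ) (lam : ℂ) : Prop :=
  (∃ v : SpaceH, v ≠ 0 ∧ ∀ w : SpaceH, IsS W g K w (lam • w) ↔ ∃ c : ℂ, w = c • v) ∧
  ¬ ∃ v w : SpaceH, v ≠ 0 ∧ IsS W g K v (lam • v) ∧ IsS W g K w (lam • w + v)

/-- All-to-all coupling `W ≡ 1`. -/
def allToAll : ℝ → ℝ → ℝ := fun _ _ => 1

/-! ### The critical curve -/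

/-- `G(λ) = ∫ (1/(λ - iω) - 1/(λ + 1 - iω)) g(ω) dω`. -/
def G (g : ℝ → ℝ) (lam : ℂ) : ℂ :=
  ∫ ω : ℝ, (1 / (lam - Complex.I * ω) - 1 / (lam + 1 - Complex.I * ω)) * (g ω : ℂ)

/-- The boundary value `G(it) = lim_{x → 0+} G(x + it)`. -/
def boundaryG (g : ℝ → ℝ) (t : ℝ) : ℂ :=
  limUnder (𝓝[>] (0 : ℝ)) (fun x : ℝ => G g (x + Complex.I * t))

/-- The critical curve `{G(it) : t ∈ ℝ}`. -/
def criticalCurve (g : ℝ → ℝ) : Set ℂ := Set.range (boundaryG g)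

/-- `x₀ = ∫ (g(0) - g(ω)) / (1 + ω²) dω`. -/
def x₀ (g : ℝ → ℝ) : ℝ := ∫ ω : ℝ, (g 0 - g ω) / (1 + ω ^ 2)

/-- `K_c = 1 / x₀`. -/
def Kc (g : ℝ → ℝ) : ℝ := (x₀ g)⁻¹

/-- Mixing (all-to-all coupling) undergoes a pitchfork bifurcation at `K = κ`, as read off from
the Penrose diagram and the spectrum of `S`: one simple real eigenvalue enters the right half-plane
through the origin (in contrast to a pair `± iν`, the Andronov–Hopf case). -/
structure IsPitchfork (g : ℝ → ℝ) (κ : ℝ) : Prop where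
  /-- The critical curve passes through `1/κ` for the parameter `t = 0` only, -/
  unique_preimage : ∀ t : ℝ, boundaryG g t = ((κ⁻¹ : ℝ) : ℂ) ↔ t = 0
  /-- and crosses the real axis there transversally. -/
  simple_crossing : ∃ d : ℂ, d.im ≠ 0 ∧ HasDerivAt (boundaryG g) d 0
  /-- Just below `κ` there is no unstable eigenvalue. -/
  stable_below : ∀ᶠ K in 𝓝[<] κ, ∀ lam : ℂ, 0 < lam.re → ¬ IsEigenvalue allToAll g K lam
  /-- Just above `κ` the unstable spectrum is one simple, real eigenvalue, which leaves the
  origin with positive speed in `K`. -/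
  real_crossing : ∃ ℓ : ℝ → ℝ, ℓ κ = 0 ∧
    (∀ᶠ K in 𝓝[>] κ, 0 < ℓ K ∧ IsSimpleEigenvalue allToAll g K (ℓ K) ∧
      ∀ lam : ℂ, 0 < lam.re → IsEigenvalue allToAll g K lam → lam = ℓ K) ∧
    ∃ s : ℝ, 0 < s ∧ HasDerivWithinAt ℓ s (Set.Ici κ) κ

end KuramotoInertia

end

noncomputable section

namespace KuramotoInertia

/-! The weight of `SpaceY` is non-decreasing in ξ, so its elements are bounded along forward
diagonals. For Re λ > 0 the equation for the shift generator is therefore solved uniquely by a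
Laplace integral (`SpaceY.eq_laplace_of_hasDerivAt_diag`). Under all-to-all coupling B has rank one.
Hence an eigenvector is a multiple of one explicit profile, constant in x, and evaluation at the
origin reduces the eigenvalue problem to K · Glap(λ) = 1 (`isEigenvalue_iff`). A generalized
eigenvector would force Glap′(λ) = 0 (`isSimpleEigenvalue_of_moment_ne_zero`).

Glap is the Laplace transform of (1 - e^{-s}) ĝ(s). Fubini identifies it with G on the right
half-plane (`Glap_eq_G`), and the exponential decay of ĝ carries it holomorphically past the
imaginary axis, which supplies the boundary values.

The roots are located by the sign of Im G. Symmetrizing in s = y - ω writes -2 Im G(x + iy) as the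
integral of a positive kernel times s (g(y - s) - g(y + s)) (`im_G_eq`), which is non-negative for y
≥ 0 when g is even and unimodal. Since g is not constant, this integral has a positive lower bound
for y > 0, uniform as x → 0+, so in the closed right half-plane Glap is real only on the real axis.
For small y the bound is linear in y, and Cauchy–Riemann turns it into Glap′ < 0 on [0, ∞)
(`moment_re_pos`).

Thus Glap decreases strictly on the half-line from x₀ (`realG_zero`) to 0. The value 1/K is taken
exactly once at a positive argument if K > 1/x₀, and never if K < 1/x₀. The speed at K_c comes from
differentiating Glap(ℓ(K)) = 1/K (`exists_branch`). -/

/-! ### The one-sided Laplace transform and the resolvent of the shift -/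

/-- The Laplace transform `∫₀^∞ e^{-λs} f(s) ds`. -/
def laplace (f : ℝ → ℂ) (lam : ℂ) : ℂ :=
  ∫ s in Set.Ioi (0 : ℝ), Complex.exp (-lam * s) * f s

lemma norm_cexp_neg_mul (lam : ℂ) (s : ℝ) :
    ‖Complex.exp (-lam * s)‖ = Real.exp (-lam.re * s) := by
  rw [Complex.norm_exp]; simp

lemma norm_laplaceIntegrand_le {f : ℝ → ℂ} {C b : ℝ} (lam : ℂ)
    (hb : ∀ s, 0 ≤ s → ‖f s‖ ≤ C * Real.exp (-b * s)) {s : ℝ} (hs : 0 ≤ s) :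
    ‖Complex.exp (-lam * s) * f s‖ ≤ C * Real.exp (-(lam.re + b) * s) := by
  rw [norm_mul, norm_cexp_neg_mul]
  calc Real.exp (-lam.re * s) * ‖f s‖
      ≤ Real.exp (-lam.re * s) * (C * Real.exp (-b * s)) :=
        mul_le_mul_of_nonneg_left (hb s hs) (Real.exp_pos _).le
    _ = C * (Real.exp (-lam.re * s) * Real.exp (-b * s)) := by ring
    _ = C * Real.exp (-(lam.re + b) * s) := by rw [← Real.exp_add]; ring_nf

lemma continuous_laplaceIntegrand {f : ℝ → ℂ} (hf : Continuous f) (lam : ℂ) :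
    Continuous fun s : ℝ => Complex.exp (-lam * s) * f s := by
  fun_prop

lemma integrableOn_laplaceIntegrand {f : ℝ → ℂ} {C b : ℝ} {lam : ℂ} (hf : Continuous f)
    (hb : ∀ s, 0 ≤ s → ‖f s‖ ≤ C * Real.exp (-b * s)) (h : 0 < lam.re + b) :
    IntegrableOn (fun s : ℝ => Complex.exp (-lam * s) * f s) (Set.Ioi 0) := by
  refine Integrable.mono' ((exp_neg_integrableOn_Ioi 0 h).const_mul C)
    (continuous_laplaceIntegrand hf lam).aestronglyMeasurable ?_
  filter_upwards [ae_restrict_mem measurableSet_Ioi] with s hs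
  exact norm_laplaceIntegrand_le lam hb (le_of_lt hs)

lemma norm_laplace_le {f : ℝ → ℂ} {C b : ℝ} {lam : ℂ}
    (hb : ∀ s, 0 ≤ s → ‖f s‖ ≤ C * Real.exp (-b * s)) (h : 0 < lam.re + b) :
    ‖laplace f lam‖ ≤ C / (lam.re + b) := by
  have h1 : ‖laplace f lam‖ ≤ ∫ s in Set.Ioi (0 : ℝ), C * Real.exp (-(lam.re + b) * s) := by
    refine norm_integral_le_of_norm_le ((exp_neg_integrableOn_Ioi 0 h).const_mul C) ?_
    filter_upwards [ae_restrict_mem measurableSet_Ioi] with s hs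
    exact norm_laplaceIntegrand_le lam hb (le_of_lt hs)
  refine h1.trans_eq ?_
  rw [integral_const_mul, integral_exp_mul_Ioi (neg_neg_of_pos h)]
  rw [mul_zero, Real.exp_zero, neg_div_neg_eq, mul_one_div]

lemma bound_exp_zero {f : ℝ → ℂ} {C : ℝ} (hb : ∀ s, 0 ≤ s → ‖f s‖ ≤ C) :
    ∀ s, 0 ≤ s → ‖f s‖ ≤ C * Real.exp (-0 * s) := by
  simpa using hb

/-- Since εs ≤ e^{εs}, a factor s costs only an arbitrarily small part ε of the exponential rate. -/
lemma bound_id_mul {f : ℝ → ℂ} {C b ε : ℝ} (hε : 0 < ε)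
    (hb : ∀ s, 0 ≤ s → ‖f s‖ ≤ C * Real.exp (-b * s)) :
    ∀ s : ℝ, 0 ≤ s → ‖(s : ℂ) * f s‖ ≤ C / ε * Real.exp (-(b - ε) * s) := by
  intro s hs
  have h1 : s ≤ Real.exp (ε * s) / ε := by
    rw [le_div_iff₀ hε]
    linarith [Real.add_one_le_exp (ε * s)]
  rw [norm_mul, Complex.norm_real, Real.norm_of_nonneg hs]
  calc s * ‖f s‖ ≤ Real.exp (ε * s) / ε * (C * Real.exp (-b * s)) :=
        mul_le_mul h1 (hb s hs) (norm_nonneg _) (by positivity)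
    _ = C / ε * (Real.exp (ε * s) * Real.exp (-b * s)) := by ring
    _ = C / ε * Real.exp (-(b - ε) * s) := by rw [← Real.exp_add]; ring_nf

lemma setIntegral_Ioi_comp_add_right (f : ℝ → ℂ) (a b : ℝ) :
    ∫ x in Set.Ioi a, f (x + b) = ∫ x in Set.Ioi (a + b), f x := by
  have h := (measurePreserving_add_right volume b).setIntegral_preimage_emb
    (measurableEmbedding_addRight b) f (Set.Ioi (a + b))
  simpa using h

/-- The Laplace transform of a translate is a tail integral. -/
lemma laplace_shift (F : ℝ → ℂ) (lam : ℂ) (t : ℝ) :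
    laplace (fun s => F (s + t)) lam
      = Complex.exp (lam * t) * ∫ r in Set.Ioi t, Complex.exp (-lam * r) * F r := by
  have h := setIntegral_Ioi_comp_add_right (fun r : ℝ => Complex.exp (-lam * r) * F r) 0 t
  rw [zero_add] at h
  rw [← h, ← integral_const_mul]
  refine integral_congr_ae (ae_of_all _ fun s => ?_)
  simp only
  rw [← mul_assoc, ← Complex.exp_add]
  congr 2
  push_cast
  ring

lemma hasDerivAt_integral_Ioi {k : ℝ → ℂ} (hk : Continuous k) (hi : IntegrableOn k (Set.Ioi 0))
    (t : ℝ) : HasDerivAt (fun t => ∫ r in Set.Ioi t, k r) (-k t) t := by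
  have hall : ∀ t, IntegrableOn k (Set.Ioi t) := by
    intro t
    refine IntegrableOn.mono_set
      ((hk.integrableOn_Icc (a := t) (b := 0)).union hi) ?_
    intro x hx
    rcases lt_or_ge 0 x with h | h
    · exact Or.inr h
    · exact Or.inl ⟨le_of_lt hx, h⟩
  have heq : (fun t => ∫ r in Set.Ioi t, k r)
      = fun t => (∫ r in Set.Ioi 0, k r) - ∫ r in (0 : ℝ)..t, k r := by
    funext s
    rw [← intervalIntegral.integral_Ioi_sub_Ioi' (hall 0) (hall s)]
    ring
  rw [heq]
  simpa using (intervalIntegral.integral_hasDerivAt_right (hk.intervalIntegrable 0 t)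
    (hk.stronglyMeasurableAtFilter _ _) hk.continuousAt).const_sub (∫ r in Set.Ioi (0 : ℝ), k r)

/-- As a function of the translation, the transform is e^{λt} times a tail integral, so the product
rule gives the resolvent equation u' = λu - F. -/
lemma hasDerivAt_laplace_shift {F : ℝ → ℂ} {lam : ℂ} (hF : Continuous F)
    (hi : IntegrableOn (fun s : ℝ => Complex.exp (-lam * s) * F s) (Set.Ioi 0)) (t : ℝ) :
    HasDerivAt (fun t : ℝ => laplace (fun s => F (s + t)) lam)
      (lam * laplace (fun s => F (s + t)) lam - F t) t := by
  have h1 := hasDerivAt_integral_Ioi (continuous_laplaceIntegrand hF lam) hi t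
  have h2 : HasDerivAt (fun t : ℝ => Complex.exp (lam * t)) (Complex.exp (lam * t) * lam) t := by
    have : HasDerivAt (fun t : ℝ => lam * (t : ℂ)) lam t := by
      simpa using (Complex.ofRealCLM.hasDerivAt (x := t)).const_mul lam
    exact this.cexp
  have h3 := h2.mul h1
  have heq : (fun t : ℝ => laplace (fun s => F (s + t)) lam)
      = fun t : ℝ => Complex.exp (lam * t) * ∫ r in Set.Ioi t, Complex.exp (-lam * r) * F r :=
    funext fun t => laplace_shift F lam t
  rw [heq, laplace_shift]
  refine h3.congr_deriv ?_
  have h4 : Complex.exp (lam * t) * Complex.exp (-lam * t) = 1 := by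
    rw [← Complex.exp_add]; simp
  linear_combination -F t * h4

/-- A bounded solution of `u' = λu - F` on the half-line is given by the Laplace transform. -/
lemma eq_laplace_of_hasDerivAt {u F : ℝ → ℂ} {C D : ℝ} {lam : ℂ} (hlam : 0 < lam.re)
    (hF : Continuous F) (hFb : ∀ s, 0 ≤ s → ‖F s‖ ≤ C)
    (hu : ∀ t, HasDerivAt u (lam * u t - F t) t) (hub : ∀ t, 0 ≤ t → ‖u t‖ ≤ D) :
    u 0 = laplace F lam := by
  have hlam' : 0 < lam.re + 0 := by simpa using hlam
  have hi := integrableOn_laplaceIntegrand hF (bound_exp_zero hFb) hlam'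
  have hd : ∀ t : ℝ, HasDerivAt (fun t : ℝ => Complex.exp (-lam * t) * u t)
      (-(Complex.exp (-lam * t) * F t)) t := by
    intro t
    have h1 : HasDerivAt (fun t : ℝ => Complex.exp (-lam * t))
        (Complex.exp (-lam * t) * (-lam)) t := by
      have : HasDerivAt (fun t : ℝ => -lam * (t : ℂ)) (-lam) t := by
        simpa using (Complex.ofRealCLM.hasDerivAt (x := t)).const_mul (-lam)
      exact this.cexp
    refine (h1.mul (hu t)).congr_deriv ?_
    ring
  -- Boundedness of u removes the homogeneous solution e^{λt}: the primitive e^{-λt} u(t) must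
  -- vanish at infinity.
  have hlim : Tendsto (fun t : ℝ => Complex.exp (-lam * t) * u t) atTop (𝓝 0) := by
    refine squeeze_zero_norm' (a := fun t : ℝ => D * Real.exp (-(lam.re + 0) * t)) ?_ ?_
    · filter_upwards [eventually_ge_atTop 0] with t ht
      exact norm_laplaceIntegrand_le lam (bound_exp_zero hub) ht
    · have : Tendsto (fun t : ℝ => -(lam.re + 0) * t) atTop atBot :=
        tendsto_id.const_mul_atTop_of_neg (neg_neg_of_pos hlam')
      simpa using (Real.tendsto_exp_atBot.comp this).const_mul D
  have h := integral_Ioi_of_hasDerivAt_of_tendsto (a := 0)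
    (hd 0).continuousAt.continuousWithinAt (fun x _ => hd x) hi.neg hlim
  simp only [Complex.ofReal_zero, mul_zero, Complex.exp_zero, one_mul, zero_sub,
    integral_neg, neg_inj] at h
  exact h.symm

/-- Iterating the transform along the shift gives the first moment. -/
lemma laplace_laplace_shift {F : ℝ → ℂ} {C : ℝ} {lam : ℂ} (hlam : 0 < lam.re)
    (hF : Continuous F) (hFb : ∀ s, 0 ≤ s → ‖F s‖ ≤ C) :
    laplace (fun s => laplace (fun r => F (r + s)) lam) lam = laplace (fun s => s * F s) lam := by
  have hlam' : 0 < lam.re + 0 := by simpa using hlam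
  have hε : 0 < lam.re / 2 := by linarith
  have hε' : 0 < lam.re + (0 - lam.re / 2) := by linarith
  have hi := integrableOn_laplaceIntegrand hF (bound_exp_zero hFb) hlam'
  set L : ℝ → ℂ := fun s => laplace (fun r => F (r + s)) lam with hL
  have hLd : ∀ t, HasDerivAt L (lam * L t - F t) t := hasDerivAt_laplace_shift hF hi
  have hLc : Continuous L := continuous_iff_continuousAt.2 fun t => (hLd t).continuousAt
  have hLb : ∀ s, 0 ≤ s → ‖L s‖ ≤ C / (lam.re + 0) := fun s hs =>
    norm_laplace_le (bound_exp_zero fun r hr => hFb _ (by linarith)) hlam'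
  have hLi := integrableOn_laplaceIntegrand hLc (bound_exp_zero hLb) hlam'
  have hsF := integrableOn_laplaceIntegrand (f := fun s : ℝ => (s : ℂ) * F s) (by fun_prop)
    (bound_id_mul hε (bound_exp_zero hFb)) hε'
  -- Integration by parts: this primitive vanishes at 0 and at infinity, and its derivative is the
  -- difference of the two integrands to be compared.
  have hd : ∀ t : ℝ, HasDerivAt (fun t : ℝ => Complex.exp (-lam * t) * (t * L t))
      (Complex.exp (-lam * t) * L t - Complex.exp (-lam * t) * (t * F t)) t := by
    intro t
    have h1 : HasDerivAt (fun t : ℝ => Complex.exp (-lam * t))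
        (Complex.exp (-lam * t) * (-lam)) t := by
      have : HasDerivAt (fun t : ℝ => -lam * (t : ℂ)) (-lam) t := by
        simpa using (Complex.ofRealCLM.hasDerivAt (x := t)).const_mul (-lam)
      exact this.cexp
    have h2 : HasDerivAt (fun t : ℝ => (t : ℂ)) 1 t := Complex.ofRealCLM.hasDerivAt
    refine (h1.mul (h2.mul (hLd t))).congr_deriv ?_
    simp only [Pi.mul_apply]
    ring
  have hlim : Tendsto (fun t : ℝ => Complex.exp (-lam * t) * (t * L t)) atTop (𝓝 0) := by
    refine squeeze_zero_norm' (a := fun t : ℝ => C / (lam.re + 0) / (lam.re / 2) *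
      Real.exp (-(lam.re + (0 - lam.re / 2)) * t)) ?_ ?_
    · filter_upwards [eventually_ge_atTop 0] with t ht
      exact norm_laplaceIntegrand_le (f := fun s : ℝ => (s : ℂ) * L s) lam
        (bound_id_mul hε (bound_exp_zero hLb)) ht
    · have : Tendsto (fun t : ℝ => -(lam.re + (0 - lam.re / 2)) * t) atTop atBot :=
        tendsto_id.const_mul_atTop_of_neg (neg_neg_of_pos hε')
      simpa using (Real.tendsto_exp_atBot.comp this).const_mul _
  have h := integral_Ioi_of_hasDerivAt_of_tendsto (a := 0)
    (hd 0).continuousAt.continuousWithinAt (fun x _ => hd x) (hLi.sub hsF) hlim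
  rw [integral_sub hLi hsF] at h
  simp only [Complex.ofReal_zero, zero_mul, mul_zero, sub_zero] at h
  exact sub_eq_zero.1 h

/-! ### The characteristic function of the density -/

variable {g : ℝ → ℝ}

lemma norm_cexp_I_mul (η ω : ℝ) : ‖Complex.exp (Complex.I * η * ω)‖ = 1 := by
  rw [Complex.norm_exp]; simp

lemma norm_ghat_le_one (hdens : IsDensity g) (η : ℝ) : ‖ghat g η‖ ≤ 1 := by
  have h : ‖ghat g η‖ ≤ ∫ ω, g ω := by
    refine norm_integral_le_of_norm_le hdens.integrable (ae_of_all _ fun ω => ?_)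
    rw [norm_mul, norm_cexp_I_mul, one_mul, Complex.norm_real,
      Real.norm_of_nonneg (hdens.nonneg ω)]
  rwa [hdens.integral_eq_one] at h

/-- The source term `(1 - e^{-ξ}) ĝ(η)`. -/
def source (g : ℝ → ℝ) (p : ℝ × ℝ) : ℂ := (1 - Real.exp (-p.1) : ℝ) * ghat g p.2

lemma norm_source_le (hdens : IsDensity g) (p : ℝ × ℝ) :
    ‖source g p‖ ≤ 1 + Real.exp (-p.1) := by
  rw [source, norm_mul, Complex.norm_real]
  have h1 : ‖1 - Real.exp (-p.1)‖ ≤ 1 + Real.exp (-p.1) := by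
    rw [Real.norm_eq_abs, abs_le]
    constructor <;> linarith [Real.exp_pos (-p.1)]
  calc _ ≤ (1 + Real.exp (-p.1)) * 1 :=
        mul_le_mul h1 (norm_ghat_le_one hdens _) (norm_nonneg _) (by positivity)
    _ = _ := mul_one _

lemma continuous_source (hc : Continuous (ghat g)) : Continuous (source g) := by
  unfold source
  fun_prop

/-- The weight tolerates exactly the growth e^{-ξ} as ξ → -∞, which places both the source and the
profile in `SpaceY`. -/
lemma weight_mul_one_add_exp_neg_le (ξ : ℝ) : weight ξ * (1 + Real.exp (-ξ)) ≤ 2 := by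
  have h1 : weight ξ ≤ 1 := min_le_right _ _
  have h2 : weight ξ * Real.exp (-ξ) ≤ 1 := by
    calc weight ξ * Real.exp (-ξ) ≤ Real.exp ξ * Real.exp (-ξ) :=
          mul_le_mul_of_nonneg_right (min_le_left _ _) (Real.exp_pos _).le
      _ = 1 := by rw [← Real.exp_add]; simp
  linarith

/-! ### Pointwise calculus in the space `Y` -/

namespace SpaceY

lemma add_apply (φ ψ : SpaceY) (p : ℝ × ℝ) : (φ + ψ) p = φ p + ψ p := rfl

lemma sub_apply (φ ψ : SpaceY) (p : ℝ × ℝ) : (φ - ψ) p = φ p - ψ p := rfl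

lemma smul_apply (c : ℂ) (φ : SpaceY) (p : ℝ × ℝ) : (c • φ) p = c * φ p := rfl

lemma zero_apply (p : ℝ × ℝ) : (0 : SpaceY) p = 0 := rfl

lemma ext_apply {φ ψ : SpaceY} (h : ∀ ξ η : ℝ, φ (ξ, η) = ψ (ξ, η)) : φ = ψ :=
  Subtype.ext (funext fun p => h p.1 p.2)

lemma continuous_coe (φ : SpaceY) : Continuous fun p => φ p := φ.2.1

lemma weight_mul_norm_le (φ : SpaceY) (p : ℝ × ℝ) : weight p.1 * ‖φ p‖ ≤ ‖φ‖ := by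
  have h1 : ‖weighted φ p‖ ≤ ‖weighted φ‖ := (weighted φ).norm_coe_le_norm p
  rwa [weighted_apply, norm_mul, Complex.norm_real, Real.norm_of_nonneg (weight_pos _).le] at h1

/-- The weight only grows in the direction of the shift, so the bound at the starting point serves
the whole forward diagonal. -/
lemma norm_apply_diag_le (φ : SpaceY) (ξ η : ℝ) {t : ℝ} (ht : 0 ≤ t) :
    ‖φ (ξ + t, η + t)‖ ≤ ‖φ‖ / weight ξ := by
  rw [le_div_iff₀ (weight_pos ξ), mul_comm]
  have h : weight ξ ≤ weight (ξ + t) :=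
    min_le_min_right _ (Real.exp_le_exp.2 (by linarith))
  exact (mul_le_mul_of_nonneg_right h (norm_nonneg _)).trans
    (weight_mul_norm_le φ (ξ + t, η + t))

/-- A function whose derivative along the diagonal is `ψ` is the resolvent applied to
`lam φ - ψ`. -/
lemma eq_laplace_of_hasDerivAt_diag {φ ψ : SpaceY} {lam : ℂ} (hlam : 0 < lam.re)
    (h : ∀ ξ η : ℝ, HasDerivAt (fun t : ℝ => φ (ξ + t, η + t)) (ψ (ξ, η)) 0) (ξ η : ℝ) :
    φ (ξ, η) = laplace (fun s => (lam • φ - ψ) (ξ + s, η + s)) lam := by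
  have hu : ∀ t : ℝ, HasDerivAt (fun t : ℝ => φ (ξ + t, η + t)) (ψ (ξ + t, η + t)) t := by
    intro t
    have h1 := h (ξ + t) (η + t)
    have h2 := HasDerivAt.comp_sub_const (f := fun s : ℝ => φ (ξ + t + s, η + t + s))
      (f' := ψ (ξ + t, η + t)) t t (by simpa using h1)
    simpa [add_assoc] using h2
  have hdiag : Continuous fun s : ℝ => ((ξ + s, η + s) : ℝ × ℝ) := by fun_prop
  have := eq_laplace_of_hasDerivAt (u := fun t : ℝ => φ (ξ + t, η + t))
    (F := fun s => (lam • φ - ψ) (ξ + s, η + s)) hlam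
    ((continuous_coe (lam • φ - ψ)).comp hdiag)
    (fun s hs => norm_apply_diag_le (lam • φ - ψ) ξ η hs)
    (fun t => (hu t).congr_deriv (by rw [sub_apply, smul_apply]; ring))
    (fun t ht => norm_apply_diag_le φ ξ η ht)
  simpa using this

end SpaceY

/-! ### The operator `S` for all-to-all coupling -/

variable {K : ℝ} {lam : ℂ}

instance : IsProbabilityMeasure volI :=
  ⟨by simp [volI]⟩

/-- The mean of `v(0, 0, ·)` over `I`. -/
def meanZero (v : SpaceH) : ℂ := ∫ y, v y (0, 0) ∂volI

lemma graphonOp_allToAll (f : ℝ → ℂ) (x : ℝ) : graphonOp allToAll f x = ∫ y, f y ∂volI := by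
  simp [graphonOp, allToAll]

/-- Variation of constants for `(S - lam) v = z`. -/
lemma IsS.repr (hlam : 0 < lam.re) {v z : SpaceH} (h : IsS allToAll g K v (lam • v + z)) :
    ∀ᵐ x ∂volI, ∀ ξ η : ℝ, v x (ξ, η) =
      laplace (fun s => K * meanZero v * source g (ξ + s, η + s) - z x (ξ + s, η + s)) lam := by
  obtain ⟨w₁, w₂, h1, h2, h3⟩ := h
  have e1 : (fun x => w₁ x + (K : ℂ) • w₂ x) =ᵐ[volI] fun x => lam • v x + z x := by
    have a1 := Lp.coeFn_add w₁ ((K : ℂ) • w₂)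
    have a2 := Lp.coeFn_smul (K : ℂ) w₂
    have a3 := Lp.coeFn_add (lam • v) z
    have a4 := Lp.coeFn_smul lam v
    rw [← h3] at a1
    filter_upwards [a1, a2, a3, a4] with x b1 b2 b3 b4
    rw [b3] at b1
    simp only [Pi.add_apply, Pi.smul_apply] at b1 b2 b4
    rw [← b2, ← b1, b4]
  filter_upwards [h1, h2, e1] with x b1 b2 b3 ξ η
  rw [SpaceY.eq_laplace_of_hasDerivAt_diag hlam b1 ξ η]
  congr 1
  funext s
  have b4 : w₁ x (ξ + s, η + s) + (K : ℂ) * w₂ x (ξ + s, η + s)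
      = lam * v x (ξ + s, η + s) + z x (ξ + s, η + s) :=
    congrArg (fun φ : SpaceY => φ (ξ + s, η + s)) b3
  have b5 := b2 (ξ + s) (η + s)
  rw [graphonOp_allToAll] at b5
  rw [SpaceY.sub_apply, SpaceY.smul_apply]
  rw [b5] at b4
  simp only [source, meanZero]
  linear_combination -b4

lemma continuous_source_diag (hc : Continuous (ghat g)) (ξ η : ℝ) :
    Continuous fun s : ℝ => source g (ξ + s, η + s) :=
  (continuous_source hc).comp (by fun_prop)

lemma norm_source_diag_le (hdens : IsDensity g) (ξ η : ℝ) :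
    ∀ s, 0 ≤ s → ‖source g (ξ + s, η + s)‖ ≤ 1 + Real.exp (-ξ) := by
  intro s hs
  refine (norm_source_le hdens _).trans ?_
  have : Real.exp (-(ξ + s)) ≤ Real.exp (-ξ) := Real.exp_le_exp.2 (by linarith)
  simpa using this

lemma integrableOn_ghat_shift (hdens : IsDensity g) (hc : Continuous (ghat g))
    (hlam : 0 < lam.re) (η : ℝ) :
    IntegrableOn (fun s : ℝ => Complex.exp (-lam * s) * ghat g (s + η)) (Set.Ioi 0) :=
  integrableOn_laplaceIntegrand (f := fun s => ghat g (s + η)) (by fun_prop)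
    (bound_exp_zero fun _ _ => norm_ghat_le_one hdens _) (by simpa using hlam)

/-- The factor e^{-(ξ+s)} splits as e^{-ξ} e^{-s}, and e^{-s} shifts λ to λ + 1. This separates ξ
from η, so regularity of the profile reduces to one variable. -/
lemma laplace_source_diag (hdens : IsDensity g) (hc : Continuous (ghat g)) (hlam : 0 < lam.re)
    (ξ η : ℝ) :
    laplace (fun s => source g (ξ + s, η + s)) lam
      = laplace (fun s => ghat g (s + η)) lam
        - Complex.exp (-ξ) * laplace (fun s => ghat g (s + η)) (lam + 1) := by
  have hlam1 : 0 < (lam + 1).re := by simp; linarith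
  unfold laplace
  rw [← integral_const_mul, ← integral_sub (integrableOn_ghat_shift hdens hc hlam η)
    ((integrableOn_ghat_shift hdens hc hlam1 η).const_mul _)]
  refine integral_congr_ae (ae_of_all _ fun s => ?_)
  have h : Complex.exp (-(lam + 1) * s) * Complex.exp (-ξ)
      = Complex.exp (-lam * s) * Complex.exp (-(ξ + s)) := by
    rw [← Complex.exp_add, ← Complex.exp_add]
    congr 1
    ring
  simp only [source]
  push_cast
  rw [add_comm η s]
  linear_combination ghat g (s + η) * h

lemma hasDerivAt_laplace_ghat (hdens : IsDensity g) (hc : Continuous (ghat g))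
    (hlam : 0 < lam.re) (η : ℝ) :
    HasDerivAt (fun η : ℝ => laplace (fun s => ghat g (s + η)) lam)
      (lam * laplace (fun s => ghat g (s + η)) lam - ghat g η) η :=
  hasDerivAt_laplace_shift hc (by simpa using integrableOn_ghat_shift hdens hc hlam 0) η

/-- The eigenfunction profile `Φ(ξ, η) = ∫₀^∞ e^{-λs} (1 - e^{-ξ-s}) ĝ(η + s) ds`. -/
def profile (hdens : IsDensity g) (hc : Continuous (ghat g)) (hlam : 0 < lam.re) : SpaceY :=
  ⟨fun p => laplace (fun s => source g (p.1 + s, p.2 + s)) lam, by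
    have hlam1 : 0 < (lam + 1).re := by simp; linarith
    have h : ∀ {mu : ℂ}, 0 < mu.re → Continuous fun η : ℝ => laplace (fun s => ghat g (s + η)) mu :=
      fun hmu => continuous_iff_continuousAt.2 fun η =>
        (hasDerivAt_laplace_ghat hdens hc hmu η).continuousAt
    have h1 := h hlam
    have h2 := h hlam1
    simp_rw [laplace_source_diag hdens hc hlam]
    have h3 : Continuous fun p : ℝ × ℝ => Complex.exp (-(p.1 : ℂ)) := by fun_prop
    exact (h1.comp continuous_snd).sub (h3.mul (h2.comp continuous_snd)), 2 / lam.re, fun p => by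
    have h1 := norm_laplace_le (lam := lam) (bound_exp_zero (norm_source_diag_le hdens p.1 p.2))
      (by simpa using hlam)
    rw [add_zero] at h1
    calc weight p.1 * ‖laplace (fun s => source g (p.1 + s, p.2 + s)) lam‖
        ≤ weight p.1 * ((1 + Real.exp (-p.1)) / lam.re) :=
          mul_le_mul_of_nonneg_left h1 (weight_pos _).le
      _ = weight p.1 * (1 + Real.exp (-p.1)) / lam.re := by ring
      _ ≤ 2 / lam.re := div_le_div_of_nonneg_right (weight_mul_one_add_exp_neg_le _) hlam.le⟩

lemma profile_apply (hdens : IsDensity g) (hc : Continuous (ghat g)) (hlam : 0 < lam.re)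
    (ξ η : ℝ) :
    profile hdens hc hlam (ξ, η) = laplace (fun s => source g (ξ + s, η + s)) lam := rfl

/-- The source term as an element of `Y`. -/
def sourceY (hdens : IsDensity g) (hc : Continuous (ghat g)) : SpaceY :=
  ⟨source g, continuous_source hc, 2, fun p =>
    (mul_le_mul_of_nonneg_left (norm_source_le hdens p) (weight_pos _).le).trans
      (weight_mul_one_add_exp_neg_le _)⟩

/-- The term e^{-ξ} contributes -1 and the transform at λ + 1 contributes λ + 1, so both parts of
the profile carry the same factor λ. -/
lemma hasDerivAt_profile_diag (hdens : IsDensity g) (hc : Continuous (ghat g))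
    (hlam : 0 < lam.re) (ξ η : ℝ) :
    HasDerivAt (fun t : ℝ => profile hdens hc hlam (ξ + t, η + t))
      (lam * profile hdens hc hlam (ξ, η) - source g (ξ, η)) 0 := by
  have hlam1 : 0 < (lam + 1).re := by simp; linarith
  simp only [profile_apply, laplace_source_diag hdens hc hlam]
  have h : ∀ {mu : ℂ}, 0 < mu.re → HasDerivAt
      (fun t : ℝ => laplace (fun s => ghat g (s + (η + t))) mu)
      (mu * laplace (fun s => ghat g (s + η)) mu - ghat g η) 0 := fun {mu} hmu => by
    have := hasDerivAt_laplace_ghat hdens hc hmu (η + 0)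
    simpa using HasDerivAt.comp_const_add
      (f := fun η : ℝ => laplace (fun s => ghat g (s + η)) mu) η 0 this
  have h3 : HasDerivAt (fun t : ℝ => Complex.exp (-((ξ + t : ℝ) : ℂ)))
      (Complex.exp (-(ξ : ℂ)) * (-1)) 0 := by
    have h4 : HasDerivAt (fun t : ℝ => -((ξ + t : ℝ) : ℂ)) (-1) 0 :=
      ((hasDerivAt_id (0 : ℝ)).const_add ξ).ofReal_comp.fun_neg.congr_deriv (by simp)
    simpa using h4.cexp
  refine ((h hlam).sub (h3.mul (h hlam1))).congr_deriv ?_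
  simp only [source, add_zero]
  push_cast
  ring

lemma meanZero_const (φ : SpaceY) : meanZero (Lp.const 2 volI φ) = φ (0, 0) := by
  have h : (fun y => (Lp.const 2 volI φ : SpaceH) y (0, 0)) =ᵐ[volI] fun _ => φ (0, 0) := by
    filter_upwards [Lp.coeFn_const 2 volI φ] with y hy
    rw [hy]
    rfl
  rw [meanZero, integral_congr_ae h]
  simp

lemma const_smul (c : ℂ) (φ : SpaceY) :
    (Lp.const 2 volI (c • φ) : SpaceH) = c • Lp.const 2 volI φ := by
  apply Lp.ext
  filter_upwards [Lp.coeFn_const 2 volI (c • φ),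
    Lp.coeFn_const 2 volI φ, Lp.coeFn_smul c (Lp.const 2 volI φ : SpaceH)]
    with x h1 h2 h3
  rw [h1, h3, Pi.smul_apply, h2]
  rfl

/-- The value `∫₀^∞ e^{-λs} (1 - e^{-s}) ĝ(s) ds`, which continues `G` beyond the imaginary
axis. -/
def Glap (g : ℝ → ℝ) (lam : ℂ) : ℂ := laplace (fun s => source g (s, s)) lam

lemma profile_zero (hdens : IsDensity g) (hc : Continuous (ghat g)) (hlam : 0 < lam.re) :
    profile hdens hc hlam (0, 0) = Glap g lam := by
  simp [profile_apply, Glap]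

/-- On the profile, L₁ - λ produces minus the source and K B produces K · Glap(λ) times the source;
the dispersion relation makes them cancel. -/
lemma isS_const_profile (hdens : IsDensity g) (hc : Continuous (ghat g)) (hlam : 0 < lam.re)
    (hK : K * Glap g lam = 1) (c : ℂ) :
    IsS allToAll g K (Lp.const 2 volI (c • profile hdens hc hlam))
      (lam • Lp.const 2 volI (c • profile hdens hc hlam)) := by
  set P := profile hdens hc hlam with hP
  set b := sourceY hdens hc with hb
  refine ⟨Lp.const 2 volI (c • (lam • P - b)), Lp.const 2 volI ((c * Glap g lam) • b), ?_, ?_, ?_⟩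
  · filter_upwards [Lp.coeFn_const 2 volI (c • P),
      Lp.coeFn_const 2 volI (c • (lam • P - b))] with x h1 h2 ξ η
    rw [h1, h2]
    exact (hasDerivAt_profile_diag hdens hc hlam ξ η).const_mul c
  · filter_upwards [Lp.coeFn_const 2 volI ((c * Glap g lam) • b)] with x h1 ξ η
    have h2 := meanZero_const (c • P)
    rw [meanZero] at h2
    rw [h1, graphonOp_allToAll, h2, SpaceY.smul_apply, hP, profile_zero]
    change (c * Glap g lam) * source g (ξ, η) = _
    simp only [source]
    ring
  · rw [← const_smul, ← const_smul, ← map_add]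
    congr 1
    refine SpaceY.ext_apply fun ξ η => ?_
    simp only [SpaceY.add_apply, SpaceY.smul_apply, SpaceY.sub_apply]
    linear_combination (-c * b (ξ, η)) * hK

lemma laplace_const_mul (c : ℂ) (f : ℝ → ℂ) (lam : ℂ) :
    laplace (fun s => c * f s) lam = c * laplace f lam := by
  unfold laplace
  rw [← integral_const_mul]
  exact integral_congr_ae (ae_of_all _ fun s => by ring)

/-- Without inhomogeneity, the variation-of-constants formula sees v only through its mean at the
origin, and its right-hand side no longer depends on x. -/
lemma eq_const_of_isS (hdens : IsDensity g) (hc : Continuous (ghat g)) (hlam : 0 < lam.re)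
    {v : SpaceH} (h : IsS allToAll g K v (lam • v)) :
    v = Lp.const 2 volI ((K * meanZero v) • profile hdens hc hlam) := by
  have h0 : IsS allToAll g K v (lam • v + 0) := by rwa [add_zero]
  apply Lp.ext
  filter_upwards [h0.repr hlam, Lp.coeFn_zero SpaceY 2 volI,
    Lp.coeFn_const 2 volI ((K * meanZero v) • profile hdens hc hlam)]
    with x h1 h2 h3
  rw [h3]
  refine SpaceY.ext_apply fun ξ η => ?_
  rw [h1 ξ η, h2]
  simp only [Pi.zero_apply, SpaceY.zero_apply, sub_zero, laplace_const_mul]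
  rfl

lemma Glap_eq_of_isS (hdens : IsDensity g) (hc : Continuous (ghat g)) (hlam : 0 < lam.re)
    {v : SpaceH} (hv : v ≠ 0) (h : IsS allToAll g K v (lam • v)) :
    K * Glap g lam = 1 := by
  have h1 := eq_const_of_isS hdens hc hlam h
  have h2 : meanZero v = K * meanZero v * Glap g lam := by
    conv_lhs => rw [h1, meanZero_const, SpaceY.smul_apply, profile_zero]
  have h3 : meanZero v ≠ 0 := by
    intro h0
    apply hv
    rw [h1, h0, mul_zero, zero_smul, map_zero]
  apply mul_left_cancel₀ h3
  linear_combination -h2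

lemma const_profile_ne_zero (hdens : IsDensity g) (hc : Continuous (ghat g))
    (hlam : 0 < lam.re) (hK : K * Glap g lam = 1) :
    (Lp.const 2 volI (profile hdens hc hlam) : SpaceH) ≠ 0 := by
  intro h0
  have h := meanZero_const (profile hdens hc hlam)
  have h1 : meanZero (0 : SpaceH) = 0 := by
    have := meanZero_const 0
    rwa [map_zero] at this
  rw [h0, h1, profile_zero] at h
  rw [← h, mul_zero] at hK
  exact zero_ne_one hK

/-- The dispersion relation. -/
theorem isEigenvalue_iff (hdens : IsDensity g) (hc : Continuous (ghat g)) (hlam : 0 < lam.re) :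
    IsEigenvalue allToAll g K lam ↔ K * Glap g lam = 1 := by
  constructor
  · rintro ⟨v, hv, h⟩
    exact Glap_eq_of_isS hdens hc hlam hv h
  · intro hK
    refine ⟨Lp.const 2 volI ((1 : ℂ) • profile hdens hc hlam), ?_,
      isS_const_profile hdens hc hlam hK 1⟩
    rw [one_smul]
    exact const_profile_ne_zero hdens hc hlam hK

/-- Algebraic simplicity holds at a root of the dispersion relation where the first moment
`∫₀^∞ s e^{-λs} (1 - e^{-s}) ĝ(s) ds` does not vanish. -/
theorem isSimpleEigenvalue_of_moment_ne_zero (hdens : IsDensity g) (hc : Continuous (ghat g))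
    (hlam : 0 < lam.re) (hK : K * Glap g lam = 1)
    (hJ : laplace (fun s => s * source g (s, s)) lam ≠ 0) :
    IsSimpleEigenvalue allToAll g K lam := by
  have hsc : Continuous fun s : ℝ => source g (s, s) := by
    simpa using continuous_source_diag hc 0 0
  have hsb : ∀ s, 0 ≤ s → ‖source g (s, s)‖ ≤ 2 := by
    intro s hs
    have := norm_source_diag_le hdens 0 0 s hs
    norm_num at this
    exact this
  refine ⟨⟨Lp.const 2 volI (profile hdens hc hlam), const_profile_ne_zero hdens hc hlam hK,
    fun w => ⟨fun h => ⟨K * meanZero w, ?_⟩, ?_⟩⟩, ?_⟩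
  · rw [← const_smul]
    exact eq_const_of_isS hdens hc hlam h
  · rintro ⟨c, rfl⟩
    rw [← const_smul]
    exact isS_const_profile hdens hc hlam hK c
  · rintro ⟨v, w, hv, h1, h2⟩
    have hv1 := eq_const_of_isS hdens hc hlam h1
    set k := K * meanZero v with hk
    have hk0 : k ≠ 0 := by
      intro h0
      rw [h0, zero_smul, map_zero] at hv1
      exact hv hv1
    set J := laplace (fun s => s * source g (s, s)) lam with hJdef
    have hP : laplace (fun s => profile hdens hc hlam (s, s)) lam = J := by
      rw [hJdef, ← laplace_laplace_shift hlam hsc hsb]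
      congr 1
      funext s
      rw [profile_apply]
      congr 1
      funext r
      rw [add_comm s r]
    have hPi : IntegrableOn (fun s : ℝ => Complex.exp (-lam * s) *
        (k * profile hdens hc hlam (s, s))) (Set.Ioi 0) := by
      refine integrableOn_laplaceIntegrand (f := fun s => k * profile hdens hc hlam (s, s))
        (C := ‖k • profile hdens hc hlam‖ / weight 0)
        (((k • profile hdens hc hlam).continuous_coe).comp
          (by fun_prop : Continuous fun s : ℝ => ((s, s) : ℝ × ℝ))) (bound_exp_zero ?_)
        (b := 0) (by simpa using hlam)
      intro s hs
      have h := (k • profile hdens hc hlam).norm_apply_diag_le 0 0 hs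
      rwa [zero_add] at h
    have hSi : IntegrableOn (fun s : ℝ => Complex.exp (-lam * s) *
        (K * meanZero w * source g (s, s))) (Set.Ioi 0) := by
      refine integrableOn_laplaceIntegrand (f := fun s => K * meanZero w * source g (s, s))
        (C := ‖K * meanZero w‖ * 2) (hsc.const_mul _) (bound_exp_zero ?_)
        (b := 0) (by simpa using hlam)
      intro s hs
      rw [norm_mul]
      exact mul_le_mul_of_nonneg_left (hsb s hs) (norm_nonneg _)
    have hw : ∀ᵐ x ∂volI, w x (0, 0) = K * meanZero w * Glap g lam - k * J := by
      have hv2 : v =ᵐ[volI] fun _ => k • profile hdens hc hlam := by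
        conv_lhs => rw [hv1]
        exact Lp.coeFn_const 2 volI (k • profile hdens hc hlam)
      filter_upwards [h2.repr hlam, hv2] with x b1 b2
      rw [b1 0 0, b2, Glap, ← laplace_const_mul, ← hP, ← laplace_const_mul]
      simp only [laplace]
      rw [← integral_sub hSi hPi]
      refine integral_congr_ae (ae_of_all _ fun s => ?_)
      simp only [zero_add, SpaceY.smul_apply]
      ring
    have hm : meanZero w = K * meanZero w * Glap g lam - k * J := by
      conv_lhs => rw [meanZero, integral_congr_ae hw]
      simp
    -- K · Glap(λ) = 1 cancels the unknown mean of w, leaving the solvability condition kJ = 0.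
    have : k * J = 0 := by linear_combination hm + meanZero w * hK
    rcases mul_eq_zero.1 this with h | h
    · exact hk0 h
    · exact hJ h

/-! ### The analytic continuation of `G` -/

lemma hasDerivAt_laplace {f : ℝ → ℂ} {C b : ℝ} {lam : ℂ} (hf : Continuous f)
    (hb : ∀ s, 0 ≤ s → ‖f s‖ ≤ C * Real.exp (-b * s)) (h : 0 < lam.re + b) :
    HasDerivAt (laplace f) (-laplace (fun s => s * f s) lam) lam := by
  -- The midpoint of -b and Re λ: of the rate m + b left on Re μ > m, half absorbs the factor s and
  -- half keeps the dominating function integrable.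
  set m : ℝ := (lam.re - b) / 2 with hm
  have hmb : 0 < (m + b) / 2 := by linarith
  have hS : {mu : ℂ | m < mu.re} ∈ 𝓝 lam :=
    (isOpen_lt continuous_const Complex.continuous_re).mem_nhds (by
      change m < lam.re
      linarith)
  have hC : 0 ≤ C / ((m + b) / 2) := by
    have := hb 0 le_rfl
    rw [mul_zero, Real.exp_zero, mul_one] at this
    exact div_nonneg ((norm_nonneg _).trans this) hmb.le
  have hsf : Continuous fun s : ℝ => (s : ℂ) * f s := by fun_prop
  have key := (hasDerivAt_integral_of_dominated_loc_of_deriv_le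
    (μ := volume.restrict (Set.Ioi (0 : ℝ)))
    (F := fun (mu : ℂ) (s : ℝ) => Complex.exp (-mu * s) * f s)
    (F' := fun (mu : ℂ) (s : ℝ) => -(Complex.exp (-mu * s) * (s * f s)))
    (bound := fun s => C / ((m + b) / 2) * Real.exp (-((m + b) / 2) * s)) hS
    (Eventually.of_forall fun mu => (continuous_laplaceIntegrand hf mu).aestronglyMeasurable)
    (integrableOn_laplaceIntegrand hf hb h)
    (continuous_laplaceIntegrand hsf lam).neg.aestronglyMeasurable ?_
    ((exp_neg_integrableOn_Ioi 0 hmb).const_mul _) ?_).2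
  · rw [integral_neg] at key
    exact key
  · filter_upwards [ae_restrict_mem measurableSet_Ioi] with s hs mu hmu
    have hs0 : (0 : ℝ) < s := hs
    have hmu' : m < mu.re := hmu
    rw [norm_neg]
    refine (norm_laplaceIntegrand_le (f := fun s : ℝ => (s : ℂ) * f s) mu
      (bound_id_mul hmb hb) hs0.le).trans (mul_le_mul_of_nonneg_left (Real.exp_le_exp.2 ?_) hC)
    have : 0 ≤ (mu.re - m) * s := mul_nonneg (by linarith) hs0.le
    nlinarith
  · refine ae_of_all _ fun s mu _ => ?_
    have h1 : HasDerivAt (fun mu : ℂ => -mu * (s : ℂ)) (-1 * s) mu :=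
      (hasDerivAt_id mu).neg.mul_const _
    refine (h1.cexp.mul_const (f s)).congr_deriv ?_
    ring

lemma exists_norm_source_diag_le_exp (hdens : IsDensity g) (hdecay : DecayAssumption g) :
    ∃ a C : ℝ, 0 < a ∧ ∀ s, 0 ≤ s → ‖source g (s, s)‖ ≤ C * Real.exp (-a * s) := by
  obtain ⟨a, ha, -, hlim⟩ := hdecay.decay
  obtain ⟨M, hM⟩ := eventually_atTop.1 (hlim.eventually (gt_mem_nhds zero_lt_one))
  -- The constant makes the right-hand side at least 1 for s < M, where only |ĝ| ≤ 1 is available.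
  refine ⟨a, Real.exp (a * |M|), ha, fun s hs => ?_⟩
  have h1 : ‖source g (s, s)‖ ≤ ‖ghat g s‖ := by
    rw [source, norm_mul, Complex.norm_real]
    refine mul_le_of_le_one_left (norm_nonneg _) ?_
    have : Real.exp (-s) ≤ 1 := Real.exp_le_one_iff.2 (by linarith)
    rw [Real.norm_eq_abs, abs_le]
    constructor <;> linarith [Real.exp_pos (-s)]
  refine h1.trans ?_
  rw [← Real.exp_add]
  rcases le_or_gt M s with h | h
  · have h2 : ‖ghat g s‖ ≤ Real.exp (-a * s) := by
      have h3 := (hM s h).le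
      calc ‖ghat g s‖ = ‖ghat g s‖ * Real.exp (a * s) * Real.exp (-a * s) := by
            rw [mul_assoc, ← Real.exp_add]; simp
        _ ≤ 1 * Real.exp (-a * s) := mul_le_mul_of_nonneg_right h3 (Real.exp_pos _).le
        _ = _ := one_mul _
    refine h2.trans (Real.exp_le_exp.2 ?_)
    have := mul_nonneg ha.le (abs_nonneg M)
    linarith
  · refine (norm_ghat_le_one hdens s).trans (Real.one_le_exp ?_)
    have : 0 ≤ a * (|M| - s) := mul_nonneg ha.le (by linarith [le_abs_self M])
    linarith

lemma continuous_source_diag_zero (hc : Continuous (ghat g)) :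
    Continuous fun s : ℝ => source g (s, s) := by
  simpa using continuous_source_diag hc 0 0

/-- `Glap` is holomorphic on a neighbourhood of the closed right half-plane. -/
lemma hasDerivAt_Glap (hdens : IsDensity g) (hdecay : DecayAssumption g) {lam : ℂ}
    (hlam : 0 ≤ lam.re) :
    HasDerivAt (Glap g) (-laplace (fun s => s * source g (s, s)) lam) lam := by
  obtain ⟨a, C, ha, hb⟩ := exists_norm_source_diag_le_exp hdens hdecay
  exact hasDerivAt_laplace (continuous_source_diag_zero hdecay.continuous_ghat) hb (by linarith)

lemma norm_Glap_le (hdens : IsDensity g) {lam : ℂ} (hlam : 0 < lam.re) :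
    ‖Glap g lam‖ ≤ 2 / lam.re := by
  have h := norm_laplace_le (lam := lam) (bound_exp_zero (norm_source_diag_le hdens 0 0))
    (by simpa using hlam)
  norm_num at h
  exact h

lemma continuous_of_decay (hdecay : DecayAssumption g) : Continuous g :=
  continuous_iff_continuousAt.2 fun ω => (hdecay.analytic ω).continuousAt

/-- Fubini after inserting the definition of ĝ: for fixed ω the s-integral is a difference of two
exponential integrals, which are the two fractions in G. -/
lemma Glap_eq_G (hdens : IsDensity g) {lam : ℂ} (hlam : 0 < lam.re) :
    Glap g lam = G g lam := by
  set F : ℝ → ℝ → ℂ := fun s ω =>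
    (Complex.exp (-lam * s) * (1 - Complex.exp (-s)) * Complex.exp (Complex.I * s * ω)) * g ω
    with hF
  have hbd : ∀ s : ℝ, 0 ≤ s → ∀ ω : ℝ, ‖Complex.exp (-lam * s) * (1 - Complex.exp (-s)) *
      Complex.exp (Complex.I * s * ω)‖ ≤ Real.exp (-lam.re * s) := by
    intro s hs ω
    rw [norm_mul, norm_mul, norm_cexp_I_mul, mul_one, norm_cexp_neg_mul]
    refine mul_le_of_le_one_right (Real.exp_pos _).le ?_
    rw [show (1 : ℂ) - Complex.exp (-s) = ((1 - Real.exp (-s) : ℝ) : ℂ) by push_cast; rfl,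
      Complex.norm_real, Real.norm_eq_abs, abs_le]
    have : Real.exp (-s) ≤ 1 := Real.exp_le_one_iff.2 (by linarith)
    constructor <;> linarith [Real.exp_pos (-s)]
  have hint : Integrable (Function.uncurry F)
      ((volume.restrict (Set.Ioi (0 : ℝ))).prod volume) := by
    have h1 : Integrable (fun z : ℝ × ℝ => Real.exp (-lam.re * z.1) * g z.2)
        ((volume.restrict (Set.Ioi (0 : ℝ))).prod volume) :=
      Integrable.mul_prod (exp_neg_integrableOn_Ioi 0 hlam) hdens.integrable
    have hmeas : AEStronglyMeasurable (Function.uncurry F)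
        ((volume.restrict (Set.Ioi (0 : ℝ))).prod volume) := by
      refine AEStronglyMeasurable.mul (Continuous.aestronglyMeasurable (by fun_prop)) ?_
      exact (Complex.continuous_ofReal.comp_aestronglyMeasurable
        hdens.integrable.aestronglyMeasurable).comp_snd
    refine h1.mono' hmeas ?_
    have hae : ∀ᵐ z ∂((volume.restrict (Set.Ioi (0 : ℝ))).prod (volume : Measure ℝ)),
        z.1 ∈ Set.Ioi (0 : ℝ) :=
      Measure.quasiMeasurePreserving_fst.ae (ae_restrict_mem measurableSet_Ioi)
    filter_upwards [hae] with z hz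
    have hz' : (0 : ℝ) < z.1 := hz
    simp only [Function.uncurry, hF]
    rw [norm_mul, Complex.norm_real, Real.norm_of_nonneg (hdens.nonneg _)]
    exact mul_le_mul_of_nonneg_right (hbd _ hz'.le _) (hdens.nonneg _)
  have hswap := integral_integral_swap hint
  have hL : Glap g lam = ∫ s in Set.Ioi (0 : ℝ), ∫ ω, F s ω := by
    refine integral_congr_ae (ae_of_all _ fun s => ?_)
    simp only [source, ghat, hF]
    rw [← integral_const_mul, ← integral_const_mul]
    refine integral_congr_ae (ae_of_all _ fun ω => ?_)
    push_cast
    ring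
  rw [hL, hswap]
  refine integral_congr_ae (ae_of_all _ fun ω => ?_)
  simp only [hF]
  rw [integral_mul_const]
  congr 1
  have h1 : (-(lam - Complex.I * ω)).re < 0 := by simpa using hlam
  have h2 : (-(lam + 1 - Complex.I * ω)).re < 0 := by simp; linarith
  have h3 : ∀ s : ℝ, Complex.exp (-lam * s) * (1 - Complex.exp (-s)) *
      Complex.exp (Complex.I * s * ω) = Complex.exp (-(lam - Complex.I * ω) * s)
        - Complex.exp (-(lam + 1 - Complex.I * ω) * s) := by
    intro s
    have e1 : Complex.exp (-(lam - Complex.I * ω) * s)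
        = Complex.exp (-lam * s) * Complex.exp (Complex.I * s * ω) := by
      rw [← Complex.exp_add]; ring_nf
    have e2 : Complex.exp (-(lam + 1 - Complex.I * ω) * s)
        = Complex.exp (-lam * s) * Complex.exp (-s) * Complex.exp (Complex.I * s * ω) := by
      rw [← Complex.exp_add, ← Complex.exp_add]; ring_nf
    rw [e1, e2]
    ring
  simp_rw [h3]
  rw [integral_sub (integrableOn_exp_mul_complex_Ioi h1 0) (integrableOn_exp_mul_complex_Ioi h2 0),
    integral_exp_mul_complex_Ioi h1, integral_exp_mul_complex_Ioi h2]
  rw [Complex.ofReal_zero, mul_zero, mul_zero, Complex.exp_zero, neg_div_neg_eq, neg_div_neg_eq]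

lemma conj_ghat (heven : ∀ ω, g (-ω) = g ω) (η : ℝ) :
    (starRingEnd ℂ) (ghat g η) = ghat g η := by
  rw [ghat, ← integral_conj, ← integral_neg_eq_self]
  refine integral_congr_ae (ae_of_all _ fun ω => ?_)
  simp [← Complex.exp_conj, heven]

lemma conj_Glap (heven : ∀ ω, g (-ω) = g ω) (lam : ℂ) :
    (starRingEnd ℂ) (Glap g lam) = Glap g ((starRingEnd ℂ) lam) := by
  rw [Glap, laplace, ← integral_conj, Glap, laplace]
  refine integral_congr_ae (ae_of_all _ fun s => ?_)
  simp only [source, map_mul, ← Complex.exp_conj, map_neg, Complex.conj_ofReal, conj_ghat heven]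

lemma Glap_ofReal_im (heven : ∀ ω, g (-ω) = g ω) (x : ℝ) : (Glap g x).im = 0 := by
  have h := conj_Glap heven x
  rw [Complex.conj_ofReal] at h
  exact Complex.conj_eq_iff_im.1 h

lemma tendsto_G_boundary (hdens : IsDensity g) (hdecay : DecayAssumption g) (t : ℝ) :
    Tendsto (fun x : ℝ => G g (x + Complex.I * t)) (𝓝[>] 0) (𝓝 (Glap g (Complex.I * t))) := by
  have h1 : ContinuousAt (Glap g) (Complex.I * t) :=
    (hasDerivAt_Glap hdens hdecay (by simp)).continuousAt
  have h2 : Tendsto (fun x : ℝ => (x : ℂ) + Complex.I * t) (𝓝[>] 0) (𝓝 (Complex.I * t)) := by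
    have : Continuous fun x : ℝ => (x : ℂ) + Complex.I * t := by fun_prop
    have h := this.tendsto 0
    simp only [Complex.ofReal_zero, zero_add] at h
    exact h.mono_left nhdsWithin_le_nhds
  refine (h1.tendsto.comp h2).congr' ?_
  filter_upwards [self_mem_nhdsWithin] with x hx
  exact Glap_eq_G hdens (by simpa using hx)

lemma boundaryG_eq (hdens : IsDensity g) (hdecay : DecayAssumption g) (t : ℝ) :
    boundaryG g t = Glap g (Complex.I * t) :=
  (tendsto_G_boundary hdens hdecay t).limUnder_eq

/-! ### Consequences of evenness and unimodality -/

/-- If the mode is at m ≥ 0, the increasing branch contains (-∞, 0], and reflection turns it into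
decrease on [0, ∞). -/
lemma IsUnimodal.antitoneOn_Ici (huni : IsUnimodal g) (heven : ∀ ω, g (-ω) = g ω) :
    AntitoneOn g (Set.Ici 0) := by
  obtain ⟨m, h1, h2⟩ := huni
  intro a ha b hb hab
  have ha' : (0 : ℝ) ≤ a := ha
  rcases le_total m 0 with hm | hm
  · exact h2 (hm.trans ha') (hm.trans hb) hab
  · rw [← heven a, ← heven b]
    exact h1 (show -b ≤ m by linarith) (show -a ≤ m by linarith) (by linarith)

lemma le_of_abs_le_abs (hanti : AntitoneOn g (Set.Ici 0)) (heven : ∀ ω, g (-ω) = g ω) {a b : ℝ}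
    (h : |a| ≤ |b|) : g b ≤ g a := by
  have habs : ∀ x, g |x| = g x := fun x => by
    rcases abs_choice x with h | h <;> rw [h]
    exact heven x
  rw [← habs a, ← habs b]
  exact hanti (abs_nonneg a) (abs_nonneg b) h

/-- Otherwise g would be constant on [0, ∞), hence on ℝ by evenness, and no constant is a
probability density on ℝ. -/
lemma exists_deriv_neg (hdens : IsDensity g) (hdecay : DecayAssumption g)
    (hanti : AntitoneOn g (Set.Ici 0)) (heven : ∀ ω, g (-ω) = g ω) :
    ∃ s₀ : ℝ, 0 < s₀ ∧ deriv g s₀ < 0 := by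
  by_contra! hcon
  have hmono : MonotoneOn g (Set.Ici 0) := by
    refine monotoneOn_of_deriv_nonneg (convex_Ici 0) (continuous_of_decay hdecay).continuousOn
      (fun x _ => (hdecay.analytic x).differentiableAt.differentiableWithinAt) ?_
    intro x hx
    rw [interior_Ici] at hx
    exact hcon x hx
  have hconst : ∀ x, 0 ≤ x → g x = g 0 := fun x hx =>
    le_antisymm (hanti Set.self_mem_Ici hx hx) (hmono Set.self_mem_Ici hx hx)
  have hg : g = fun _ => g 0 := by
    funext x
    rcases le_total 0 x with h | h
    · exact hconst x h
    · rw [← heven x]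
      exact hconst _ (by linarith)
  have h1 := hdens.integral_eq_one
  rw [hg] at h1
  -- The integral of a constant over ℝ evaluates to 0, because the infinite measure of ℝ has real
  -- value 0.
  simp [Measure.real] at h1

/-- Equal values at a and b would make the monotone g constant between them, so its derivative at s₀
would vanish. -/
lemma lt_of_deriv_neg (hanti : AntitoneOn g (Set.Ici 0)) {a b s₀ : ℝ} (ha : 0 ≤ a)
    (has : a < s₀) (hsb : s₀ < b) (hd : deriv g s₀ < 0) : g b < g a := by
  refine lt_of_le_of_ne (hanti ha (show (0 : ℝ) ≤ b by linarith) (by linarith)) fun hne => ?_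
  have h1 : g =ᶠ[𝓝 s₀] fun _ => g a := by
    filter_upwards [Ioo_mem_nhds has hsb] with x hx
    have hx0 : 0 ≤ x := ha.trans hx.1.le
    refine le_antisymm (hanti ha hx0 hx.1.le) ?_
    rw [← hne]
    exact hanti hx0 (show (0 : ℝ) ≤ b by linarith) hx.2.le
  rw [h1.deriv_eq, deriv_const] at hd
  exact lt_irrefl _ hd

/-! ### The sign of the imaginary part of `G` -/

/-- The even kernel in the formula for the imaginary part of `G`. -/
def imKernel (x s : ℝ) : ℝ := (2 * x + 1) / ((x ^ 2 + s ^ 2) * ((x + 1) ^ 2 + s ^ 2))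

/-- `s (g(y - s) - g(y + s))`, which is non-negative for `y ≥ 0`. -/
def oddDiff (g : ℝ → ℝ) (y s : ℝ) : ℝ := s * (g (y - s) - g (y + s))

lemma oddDiff_nonneg (hanti : AntitoneOn g (Set.Ici 0)) (heven : ∀ ω, g (-ω) = g ω) {y : ℝ}
    (hy : 0 ≤ y) (s : ℝ) : 0 ≤ oddDiff g y s := by
  rcases le_total 0 s with hs | hs
  · refine mul_nonneg hs (sub_nonneg.2 (le_of_abs_le_abs hanti heven ?_))
    exact sq_le_sq.1 (by nlinarith [mul_nonneg hy hs])
  · refine mul_nonneg_of_nonpos_of_nonpos hs (sub_nonpos.2 (le_of_abs_le_abs hanti heven ?_))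
    exact sq_le_sq.1 (by nlinarith [mul_nonneg hy (neg_nonneg.2 hs)])

lemma imKernel_nonneg {x : ℝ} (hx : 0 ≤ x) (s : ℝ) : 0 ≤ imKernel x s := by
  unfold imKernel; positivity

lemma norm_one_div_sub_I_mul_le {lam : ℂ} (hlam : 0 < lam.re) (ω : ℝ) :
    ‖1 / (lam - Complex.I * ω)‖ ≤ 1 / lam.re := by
  rw [norm_div, norm_one]
  refine one_div_le_one_div_of_le hlam ?_
  have h := Complex.abs_re_le_norm (lam - Complex.I * ω)
  have h2 : (lam - Complex.I * ω).re = lam.re := by simp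
  rw [h2] at h
  exact (le_abs_self _).trans h

lemma sub_I_mul_ne_zero {lam : ℂ} (hlam : 0 < lam.re) (ω : ℝ) : lam - Complex.I * ω ≠ 0 := by
  intro h
  have := congrArg Complex.re h
  simp at this
  linarith

lemma integrable_G (hdens : IsDensity g) {lam : ℂ} (hlam : 0 < lam.re) :
    Integrable fun ω : ℝ =>
      (1 / (lam - Complex.I * ω) - 1 / (lam + 1 - Complex.I * ω)) * (g ω : ℂ) := by
  have hlam1 : 0 < (lam + 1).re := by simp; linarith
  refine hdens.integrable.ofReal.bdd_mul (c := 1 / lam.re + 1 / (lam + 1).re) ?_ ?_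
  · refine Continuous.aestronglyMeasurable ?_
    have h : ∀ {mu : ℂ}, 0 < mu.re → Continuous fun ω : ℝ => 1 / (mu - Complex.I * ω) :=
      fun hmu => continuous_const.div (by fun_prop) (sub_I_mul_ne_zero hmu)
    exact (h hlam).sub (h hlam1)
  · exact ae_of_all _ fun ω => (norm_sub_le _ _).trans
      (add_le_add (norm_one_div_sub_I_mul_le hlam ω) (norm_one_div_sub_I_mul_le hlam1 ω))

/-- The argument of g stays in the form y - (y - ω), so that the integrand is visibly a function of
s = y - ω. -/
lemma im_integrand (x y ω : ℝ) (hx : 0 < x) :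
    ((1 / ((x + Complex.I * y : ℂ) - Complex.I * ω)
      - 1 / ((x + Complex.I * y : ℂ) + 1 - Complex.I * ω)) * (g ω : ℂ)).im
      = -((y - ω) * imKernel x (y - ω) * g (y - (y - ω))) := by
  have h1 : x ^ 2 + (y - ω) ^ 2 ≠ 0 := by positivity
  have h2 : (x + 1) ^ 2 + (y - ω) ^ 2 ≠ 0 := by positivity
  rw [Complex.im_mul_ofReal, sub_sub_cancel, imKernel]
  simp only [one_div, Complex.sub_im, Complex.inv_im, Complex.normSq_apply]
  simp
  rw [show x * x + (y - ω) * (y - ω) = x ^ 2 + (y - ω) ^ 2 by ring,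
    show (x + 1) * (x + 1) + (y - ω) * (y - ω) = (x + 1) ^ 2 + (y - ω) ^ 2 by ring]
  field_simp
  ring

lemma integrable_imKernel_shift (hdens : IsDensity g) {x : ℝ} (hx : 0 < x) (y : ℝ) :
    Integrable fun s => s * imKernel x s * g (y - s) := by
  have h1 := (integrable_G hdens (lam := x + Complex.I * y) (by simpa using hx)).im
  have h2 : Integrable fun ω => (y - ω) * imKernel x (y - ω) * g (y - (y - ω)) := by
    refine h1.neg.congr (ae_of_all _ fun ω => ?_)
    have h := im_integrand (g := g) x y ω hx
    simp only [Pi.neg_apply]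
    rw [← neg_eq_iff_eq_neg] at h
    exact h
  have h3 := h2.comp_sub_left y
  simpa using h3

/-- The kernel is even in s and the factor s is odd, so averaging over s and -s replaces g(y - s) by
the difference in `oddDiff`; hence the factor 2. -/
lemma im_G_eq (hdens : IsDensity g) {x : ℝ} (hx : 0 < x) (y : ℝ) :
    Integrable (fun s => imKernel x s * oddDiff g y s) ∧
    2 * (G g (x + Complex.I * y)).im = -∫ s, imKernel x s * oddDiff g y s := by
  have hi := integrable_imKernel_shift hdens hx y
  have hi' : Integrable fun s => s * imKernel x s * g (y + s) := by
    refine hi.comp_neg.neg.congr (ae_of_all _ fun s => ?_)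
    simp [imKernel]
  have h1 : (G g (x + Complex.I * y)).im = -∫ s, s * imKernel x s * g (y - s) := by
    rw [← integral_sub_left_eq_self (fun s => s * imKernel x s * g (y - s)) volume y,
      ← integral_neg]
    have h2 : (G g (x + Complex.I * y)).im
        = ∫ ω : ℝ, ((1 / ((x + Complex.I * y : ℂ) - Complex.I * ω)
      - 1 / ((x + Complex.I * y : ℂ) + 1 - Complex.I * ω)) * (g ω : ℂ)).im :=
      (Complex.imCLM.integral_comp_comm
        (integrable_G hdens (lam := x + Complex.I * y) (by simpa using hx))).symm
    rw [h2]
    exact integral_congr_ae (ae_of_all _ fun ω => im_integrand x y ω hx)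
  have h3 : ∫ s, s * imKernel x s * g (y - s) = -∫ s, s * imKernel x s * g (y + s) := by
    rw [← integral_neg_eq_self, ← integral_neg]
    refine integral_congr_ae (ae_of_all _ fun s => ?_)
    simp [imKernel]
  have h4 : (fun s => imKernel x s * oddDiff g y s)
      = fun s => s * imKernel x s * g (y - s) - s * imKernel x s * g (y + s) := by
    funext s
    simp only [oddDiff]
    ring
  rw [h4]
  refine ⟨hi.sub hi', ?_⟩
  rw [integral_sub hi hi', h1]
  linarith

/-- A quantitative bound on the imaginary part, uniform up to the imaginary axis. -/
lemma im_G_le (hdens : IsDensity g) (hanti : AntitoneOn g (Set.Ici 0))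
    (heven : ∀ ω, g (-ω) = g ω) {x X y p q m : ℝ} (hx : 0 < x) (hxX : x ≤ X) (hy : 0 ≤ y)
    (hp : 0 < p) (hpq : p ≤ q) (hm0 : 0 ≤ m) (hm : ∀ s ∈ Set.Icc p q, m ≤ oddDiff g y s) :
    (G g (x + Complex.I * y)).im
      ≤ -((q - p) / (2 * ((X ^ 2 + q ^ 2) * ((X + 1) ^ 2 + q ^ 2))) * m) := by
  obtain ⟨hi, hG⟩ := im_G_eq hdens hx y
  -- A lower bound for the kernel on [p, q] when 0 < x ≤ X: the numerator is at least 1 and the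
  -- denominator is largest at x = X, s = q.
  set κ : ℝ := 1 / ((X ^ 2 + q ^ 2) * ((X + 1) ^ 2 + q ^ 2)) with hκ
  have hκ0 : 0 ≤ κ := by positivity
  have h1 : ∫ s in Set.Icc p q, imKernel x s * oddDiff g y s
      ≤ ∫ s, imKernel x s * oddDiff g y s :=
    setIntegral_le_integral hi (ae_of_all _ fun s =>
      mul_nonneg (imKernel_nonneg hx.le s) (oddDiff_nonneg hanti heven hy s))
  have h2 : ∫ s in Set.Icc p q, κ * m ≤ ∫ s in Set.Icc p q, imKernel x s * oddDiff g y s := by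
    refine setIntegral_mono_on (integrableOn_const (by simp)) hi.integrableOn
      measurableSet_Icc fun s hs => ?_
    refine mul_le_mul ?_ (hm s hs) hm0 (imKernel_nonneg hx.le s)
    have hs0 : 0 < s := hp.trans_le hs.1
    have e1 : s ^ 2 ≤ q ^ 2 := pow_le_pow_left₀ hs0.le hs.2 2
    have e2 : x ^ 2 ≤ X ^ 2 := pow_le_pow_left₀ hx.le hxX 2
    have e3 : (x + 1) ^ 2 ≤ (X + 1) ^ 2 := pow_le_pow_left₀ (by linarith) (by linarith) 2
    rw [hκ, imKernel]
    refine div_le_div₀ (by linarith) (by linarith) (by positivity) ?_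
    exact mul_le_mul (add_le_add e2 e1) (add_le_add e3 e1) (by positivity) (by positivity)
  have h3 : ∫ s in Set.Icc p q, κ * m = (q - p) * (κ * m) := by
    rw [setIntegral_const, Real.volume_real_Icc_of_le hpq, smul_eq_mul]
  have h4 : (q - p) / (2 * ((X ^ 2 + q ^ 2) * ((X + 1) ^ 2 + q ^ 2))) * m
      = (q - p) * (κ * m) / 2 := by
    rw [hκ]
    field_simp
  rw [h4]
  linarith

lemma continuous_oddDiff (hg : Continuous g) (y : ℝ) : Continuous (oddDiff g y) := by
  unfold oddDiff; fun_prop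

/-- For `y > 0` the imaginary part of `G` is bounded away from `0` near the imaginary axis. -/
lemma exists_im_G_le (hdens : IsDensity g) (hdecay : DecayAssumption g)
    (hanti : AntitoneOn g (Set.Ici 0)) (heven : ∀ ω, g (-ω) = g ω) (X : ℝ) {y : ℝ}
    (hy : 0 < y) :
    ∃ c : ℝ, 0 < c ∧ ∀ x : ℝ, 0 < x → x ≤ X → (G g (x + Complex.I * y)).im ≤ -c := by
  obtain ⟨s₀, hs₀, hd⟩ := exists_deriv_neg hdens hdecay hanti heven
  obtain ⟨s, hs, hpos⟩ : ∃ s : ℝ, 0 < s ∧ 0 < oddDiff g y s := by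
    -- With s = max(y, s₀), evenness gives g(y - s) = g(s - y) with s - y ≥ 0, and s₀ lies strictly
    -- between s - y and s + y.
    refine ⟨max y s₀, lt_max_of_lt_left hy, ?_⟩
    refine mul_pos (lt_max_of_lt_left hy) (sub_pos.2 ?_)
    have e1 : g (y - max y s₀) = g (max y s₀ - y) := by rw [← heven]; ring_nf
    rw [e1]
    refine lt_of_deriv_neg hanti (sub_nonneg.2 (le_max_left _ _)) ?_ ?_ hd
    · rcases le_total y s₀ with h | h
      · rw [max_eq_right h]; linarith
      · rw [max_eq_left h]; linarith
    · linarith [le_max_right y s₀]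
  have hev : ∀ᶠ r in 𝓝 s, oddDiff g y s / 2 < oddDiff g y r :=
    (continuous_oddDiff (continuous_of_decay hdecay) y).continuousAt.eventually
      (lt_mem_nhds (by linarith))
  obtain ⟨ε, hε, hball⟩ := Metric.eventually_nhds_iff.1 hev
  set δ := min (ε / 2) (s / 2) with hδ
  have hδ0 : 0 < δ := lt_min (by linarith) (by linarith)
  have hδ1 : δ ≤ ε / 2 := min_le_left _ _
  have hδ2 : δ ≤ s / 2 := min_le_right _ _
  refine ⟨_, ?_, fun x hx hxX => im_G_le (p := s - δ) (q := s + δ)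
    (m := oddDiff g y s / 2) hdens hanti heven hx hxX hy.le (by linarith) (by linarith)
    (by linarith) fun r hr => ?_⟩
  · have : 0 < s + δ - (s - δ) := by linarith
    have : 0 < s + δ := by linarith
    positivity
  · refine (hball ?_).le
    rw [Real.dist_eq, abs_lt]
    constructor <;> linarith [hr.1, hr.2]

/-- Near the real axis the imaginary part of `G` is bounded by a negative multiple of `y`. -/
lemma exists_im_G_le_mul (hdens : IsDensity g) (hdecay : DecayAssumption g)
    (hanti : AntitoneOn g (Set.Ici 0)) (heven : ∀ ω, g (-ω) = g ω) (X : ℝ) :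
    ∃ c δ : ℝ, 0 < c ∧ 0 < δ ∧ ∀ x y : ℝ, 0 < x → x ≤ X → 0 < y → y < δ →
      (G g (x + Complex.I * y)).im ≤ -(c * y) := by
  obtain ⟨s₀, hs₀, hd⟩ := exists_deriv_neg hdens hdecay hanti heven
  have hstrict : HasStrictDerivAt g (deriv g s₀) s₀ := (hdecay.analytic s₀).hasStrictDerivAt
  -- Strict differentiability compares g(s + y) with g(s - y) uniformly for s near s₀. The tolerance
  -- |g′(s₀)|/2 leaves a drop of at least |g′(s₀)| y out of 2|g′(s₀)| y.
  have hlo := hstrict.isLittleO.def (c := -deriv g s₀ / 2) (by linarith)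
  obtain ⟨ε, hε, hball⟩ := Metric.eventually_nhds_iff.1 hlo
  set δ := min (ε / 2) (s₀ / 2) with hδ
  have hδ0 : 0 < δ := lt_min (by linarith) (by linarith)
  have hδ1 : δ ≤ ε / 2 := min_le_left _ _
  have hδ2 : δ ≤ s₀ / 2 := min_le_right _ _
  set d := deriv g s₀ with hdd
  refine ⟨(s₀ + δ / 2 - (s₀ - δ / 2)) /
    (2 * ((X ^ 2 + (s₀ + δ / 2) ^ 2) * ((X + 1) ^ 2 + (s₀ + δ / 2) ^ 2))) * (s₀ / 2 * (-d)), δ,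
    ?_, hδ0, fun x y hx hxX hy hyδ => ?_⟩
  · have h1 : 0 < s₀ + δ / 2 - (s₀ - δ / 2) := by linarith
    have h2 : 0 < -d := by linarith
    positivity
  · have h := im_G_le (p := s₀ - δ / 2) (q := s₀ + δ / 2) (m := s₀ / 2 * (-d) * y)
      hdens hanti heven hx hxX hy.le (by linarith) (by linarith)
      (mul_nonneg (mul_nonneg (by linarith) (by linarith)) hy.le) fun s hs => ?_
    · rw [mul_assoc]
      exact h
    · have hb := hball (y := (s + y, s - y)) (by
        rw [Prod.dist_eq, Real.dist_eq, Real.dist_eq]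
        refine max_lt ?_ ?_ <;> rw [abs_lt] <;> constructor <;> linarith [hs.1, hs.2])
      have e1 : (s + y) - (s - y) = 2 * y := by ring
      simp only [ContinuousLinearMap.toSpanSingleton_apply, smul_eq_mul, e1] at hb
      rw [Real.norm_eq_abs, Real.norm_eq_abs, abs_of_pos (by linarith : 0 < 2 * y)] at hb
      have hb' := (abs_le.1 hb).2
      have e2 : g (y - s) = g (s - y) := by rw [← heven]; ring_nf
      rw [oddDiff, e2, add_comm y s]
      have e3 : (-d) * y ≤ g (s - y) - g (s + y) := by linarith
      have e4 : 0 ≤ (-d) * y := mul_nonneg (by linarith) hy.le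
      rw [mul_assoc]
      exact mul_le_mul (by linarith [hs.1]) e3 e4 (by linarith [hs.1])

/-! ### The roots of the dispersion relation -/

/-- A uniform bound on the right of the imaginary axis passes to the imaginary axis. -/
lemma Glap_im_le_of_forall (hdens : IsDensity g) (hdecay : DecayAssumption g) {x y c : ℝ}
    (hx : 0 ≤ x)
    (h : ∀ x' : ℝ, 0 < x' → x' ≤ x + 1 → (G g (x' + Complex.I * y)).im ≤ -c) :
    (Glap g (x + Complex.I * y)).im ≤ -c := by
  rcases hx.eq_or_lt with rfl | hx
  · have h1 := tendsto_G_boundary hdens hdecay y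
    have h2 := (Complex.continuous_im.tendsto _).comp h1
    rw [Complex.ofReal_zero, zero_add]
    refine le_of_tendsto h2 ?_
    filter_upwards [Ioc_mem_nhdsGT (show (0 : ℝ) < 0 + 1 by norm_num)] with x' hx'
    exact h x' hx'.1 hx'.2
  · rw [Glap_eq_G hdens (by simpa using hx)]
    exact h x hx (by linarith)

lemma Glap_im_neg (hdens : IsDensity g) (hdecay : DecayAssumption g)
    (hanti : AntitoneOn g (Set.Ici 0)) (heven : ∀ ω, g (-ω) = g ω) {x y : ℝ} (hx : 0 ≤ x)
    (hy : 0 < y) : (Glap g (x + Complex.I * y)).im < 0 := by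
  obtain ⟨c, hc, h⟩ := exists_im_G_le hdens hdecay hanti heven (x + 1) hy
  have := Glap_im_le_of_forall hdens hdecay hx h
  linarith

/-- The strict sign in the upper half-plane passes to the lower one by conjugation symmetry, which
comes from evenness of g. -/
lemma im_eq_zero_of_Glap_im_eq_zero (hdens : IsDensity g) (hdecay : DecayAssumption g)
    (hanti : AntitoneOn g (Set.Ici 0)) (heven : ∀ ω, g (-ω) = g ω) {lam : ℂ}
    (hlam : 0 ≤ lam.re) (h : (Glap g lam).im = 0) : lam.im = 0 := by
  have hform : ∀ mu : ℂ, (mu.re : ℂ) + Complex.I * (mu.im : ℂ) = mu := fun mu => by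
    rw [mul_comm]; exact Complex.re_add_im mu
  rcases lt_trichotomy lam.im 0 with h1 | h1 | h1
  · have h2 := Glap_im_neg hdens hdecay hanti heven (x := ((starRingEnd ℂ) lam).re)
      (y := ((starRingEnd ℂ) lam).im) (by simpa using hlam) (by simpa using h1)
    rw [hform, ← conj_Glap heven, Complex.conj_im, h] at h2
    simp at h2
  · exact h1
  · have h2 := Glap_im_neg hdens hdecay hanti heven hlam h1
    rw [hform, h] at h2
    exact absurd h2 (lt_irrefl 0)

/-- The first moment `∫₀^∞ s e^{-xs} (1 - e^{-s}) ĝ(s) ds = -G'(x)` is positive. -/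
lemma moment_re_pos (hdens : IsDensity g) (hdecay : DecayAssumption g)
    (hanti : AntitoneOn g (Set.Ici 0)) (heven : ∀ ω, g (-ω) = g ω) {x : ℝ} (hx : 0 ≤ x) :
    0 < (laplace (fun s => s * source g (s, s)) x).re := by
  obtain ⟨c, δ, hc, hδ, h⟩ := exists_im_G_le_mul hdens hdecay hanti heven (x + 1)
  have hb : ∀ y : ℝ, 0 < y → y < δ → (Glap g (x + Complex.I * y)).im ≤ -(c * y) :=
    fun y hy hyδ => Glap_im_le_of_forall hdens hdecay hx fun x' h1 h2 => h x' y h1 h2 hy hyδ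
  set J := laplace (fun s => s * source g (s, s)) x with hJ
  have h1 : HasDerivAt (fun y : ℝ => (x : ℂ) + Complex.I * y) Complex.I 0 := by
    simpa using ((hasDerivAt_id (0 : ℝ)).ofReal_comp.const_mul Complex.I).const_add (x : ℂ)
  have h2 : HasDerivAt (fun y : ℝ => Glap g (x + Complex.I * y)) (-J * Complex.I) 0 := by
    refine HasDerivAt.comp (0 : ℝ) (h₂ := Glap g) ?_ h1
    simpa using hasDerivAt_Glap hdens hdecay (lam := x) (by simpa using hx)
  -- Cauchy–Riemann: the vertical derivative of Im Glap at a real point is Re Glap′ = -Re J. The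
  -- linear bound in y survives in the difference quotient, which a bare strict sign would not.
  have h3 : HasDerivAt (fun y : ℝ => (Glap g (x + Complex.I * y)).im) (-J.re) 0 := by
    have := Complex.imCLM.hasFDerivAt.comp_hasDerivAt (0 : ℝ) h2
    simpa using! this
  have h4 := (hasDerivAt_iff_tendsto_slope.1 h3).mono_left
    (nhdsWithin_mono 0 (fun y (hy : y ∈ Set.Ioi (0 : ℝ)) => ne_of_gt hy))
  have h5 : -J.re ≤ -c := by
    refine le_of_tendsto h4 ?_
    filter_upwards [Ioo_mem_nhdsGT hδ] with y hy
    have e := hb y hy.1 hy.2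
    rw [slope_def_field]
    simp only [Complex.ofReal_zero, mul_zero, add_zero, Glap_ofReal_im heven, sub_zero]
    rw [div_le_iff₀ hy.1]
    linarith
  linarith

/-- The continuation of `G` restricted to the real axis. -/
def realG (g : ℝ → ℝ) (x : ℝ) : ℝ := (Glap g x).re

lemma Glap_ofReal (heven : ∀ ω, g (-ω) = g ω) (x : ℝ) : Glap g x = (realG g x : ℂ) :=
  Complex.ext (by simp [realG]) (by simp [Glap_ofReal_im heven])

lemma hasDerivAt_realG (hdens : IsDensity g) (hdecay : DecayAssumption g) {x : ℝ} (hx : 0 ≤ x) :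
    HasDerivAt (realG g) (-(laplace (fun s => s * source g (s, s)) x).re) x := by
  have h := hasDerivAt_Glap hdens hdecay (lam := x) (by simpa using hx)
  simpa using! h.real_of_complex

lemma continuousOn_realG (hdens : IsDensity g) (hdecay : DecayAssumption g) :
    ContinuousOn (realG g) (Set.Ici 0) := fun _ hx =>
  (hasDerivAt_realG hdens hdecay hx).continuousAt.continuousWithinAt

lemma strictAntiOn_realG (hdens : IsDensity g) (hdecay : DecayAssumption g)
    (hanti : AntitoneOn g (Set.Ici 0)) (heven : ∀ ω, g (-ω) = g ω) :
    StrictAntiOn (realG g) (Set.Ici 0) := by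
  refine strictAntiOn_of_deriv_neg (convex_Ici 0) (continuousOn_realG hdens hdecay) ?_
  intro x hx
  rw [interior_Ici] at hx
  have hx' : 0 ≤ x := le_of_lt hx
  rw [(hasDerivAt_realG hdens hdecay hx').deriv]
  have := moment_re_pos hdens hdecay hanti heven hx'
  linarith

lemma tendsto_realG_atTop (hdens : IsDensity g) : Tendsto (realG g) atTop (𝓝 0) := by
  refine squeeze_zero_norm' (a := fun x : ℝ => 2 / x) ?_ (tendsto_const_nhds.div_atTop tendsto_id)
  filter_upwards [eventually_gt_atTop 0] with x hx
  have h := norm_Glap_le hdens (lam := x) (by simpa using hx)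
  rw [Complex.ofReal_re] at h
  exact (Complex.abs_re_le_norm _).trans h

lemma realG_pos (hdens : IsDensity g) (hdecay : DecayAssumption g)
    (hanti : AntitoneOn g (Set.Ici 0)) (heven : ∀ ω, g (-ω) = g ω) {x : ℝ} (hx : 0 ≤ x) :
    0 < realG g x := by
  have hs := strictAntiOn_realG hdens hdecay hanti heven
  have h1 : 0 ≤ realG g (x + 1) := by
    refine le_of_tendsto (tendsto_realG_atTop hdens) ?_
    filter_upwards [eventually_ge_atTop (x + 1)] with y hy
    exact hs.antitoneOn (show (0 : ℝ) ≤ x + 1 by linarith) (show (0 : ℝ) ≤ y by linarith) hy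
  exact h1.trans_lt (hs hx (show (0 : ℝ) ≤ x + 1 by linarith) (by linarith))

/-- A Poisson integral after rescaling. -/
lemma integral_poisson_eq {x : ℝ} (hx : 0 < x) :
    ∫ ω, x / (x ^ 2 + ω ^ 2) * g ω = ∫ u, (1 + u ^ 2)⁻¹ * g (x * u) := by
  have h := Measure.integral_comp_mul_left (fun ω => x / (x ^ 2 + ω ^ 2) * g ω) x
  rw [abs_of_pos (inv_pos.2 hx), smul_eq_mul] at h
  have h1 : ∫ ω, x / (x ^ 2 + ω ^ 2) * g ω
      = x * ∫ u, x / (x ^ 2 + (x * u) ^ 2) * g (x * u) := by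
    rw [h]; field_simp
  rw [h1, ← integral_const_mul]
  refine integral_congr_ae (ae_of_all _ fun u => ?_)
  have : 1 + u ^ 2 ≠ 0 := by positivity
  simp only
  field_simp

lemma abs_le_zero_value (hdens : IsDensity g) (hanti : AntitoneOn g (Set.Ici 0))
    (heven : ∀ ω, g (-ω) = g ω) (ω : ℝ) : |g ω| ≤ g 0 := by
  rw [abs_of_nonneg (hdens.nonneg ω)]
  exact le_of_abs_le_abs hanti heven (by simp)

lemma integrable_poisson_rescaled (hdens : IsDensity g) (hg : Continuous g)
    (hanti : AntitoneOn g (Set.Ici 0)) (heven : ∀ ω, g (-ω) = g ω) (x : ℝ) :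
    Integrable fun u => (1 + u ^ 2)⁻¹ * g (x * u) := by
  refine integrable_inv_one_add_sq.mul_bdd (c := g 0)
    (Continuous.aestronglyMeasurable (by fun_prop))
    (ae_of_all _ fun u => abs_le_zero_value hdens hanti heven _)

lemma integrable_poisson (hdens : IsDensity g) {x : ℝ} (hx : 0 < x) :
    Integrable fun ω => x / (x ^ 2 + ω ^ 2) * g ω := by
  refine hdens.integrable.bdd_mul (c := 1 / x) ?_ (ae_of_all _ fun ω => ?_)
  · exact (continuous_const.div (by fun_prop) fun ω => by positivity).aestronglyMeasurable
  · rw [Real.norm_of_nonneg (by positivity), div_le_div_iff₀ (by positivity) hx]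
    nlinarith [sq_nonneg ω]

/-- The real parts of the two fractions are Poisson kernels. Rescaling both to the fixed weight 1/(1
+ u²) avoids the concentration of x/(x² + ω²) as x → 0. -/
lemma realG_eq_integral (hdens : IsDensity g) (hg : Continuous g)
    (hanti : AntitoneOn g (Set.Ici 0)) (heven : ∀ ω, g (-ω) = g ω) {x : ℝ} (hx : 0 < x) :
    realG g x = ∫ u, (1 + u ^ 2)⁻¹ * (g (x * u) - g ((x + 1) * u)) := by
  have hx1 : 0 < x + 1 := by linarith
  have hre : 0 < ((x : ℂ)).re := by simpa using hx
  have h1 : realG g x = ∫ ω, (x / (x ^ 2 + ω ^ 2) * g ω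
      - (x + 1) / ((x + 1) ^ 2 + ω ^ 2) * g ω) := by
    rw [realG, Glap_eq_G hdens hre]
    refine (Complex.reCLM.integral_comp_comm (integrable_G hdens hre)).symm.trans ?_
    refine integral_congr_ae (ae_of_all _ fun ω => ?_)
    simp only [Complex.reCLM_apply, Complex.re_mul_ofReal, one_div, Complex.sub_re, Complex.inv_re,
      Complex.normSq_apply]
    simp
    ring
  rw [h1, integral_sub (integrable_poisson hdens hx) (integrable_poisson hdens hx1),
    integral_poisson_eq hx, integral_poisson_eq hx1,
    ← integral_sub (integrable_poisson_rescaled hdens hg hanti heven x)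
      (integrable_poisson_rescaled hdens hg hanti heven (x + 1))]
  exact integral_congr_ae (ae_of_all _ fun u => by ring)

/-- As x → 0+ the rescaled Poisson integrals converge by dominated convergence, since g is bounded
by g(0) and 1/(1 + u²) is integrable. -/
lemma realG_zero (hdens : IsDensity g) (hdecay : DecayAssumption g)
    (hanti : AntitoneOn g (Set.Ici 0)) (heven : ∀ ω, g (-ω) = g ω) : realG g 0 = x₀ g := by
  have hg := continuous_of_decay hdecay
  have h1 : Tendsto (realG g) (𝓝[>] 0) (𝓝 (realG g 0)) :=
    (hasDerivAt_realG hdens hdecay le_rfl).continuousAt.tendsto.mono_left nhdsWithin_le_nhds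
  refine tendsto_nhds_unique h1 ?_
  have h2 : Tendsto (fun x : ℝ => ∫ u, (1 + u ^ 2)⁻¹ * (g (x * u) - g ((x + 1) * u))) (𝓝[>] 0)
      (𝓝 (∫ u, (1 + u ^ 2)⁻¹ * (g (0 * u) - g ((0 + 1) * u)))) := by
    refine tendsto_integral_filter_of_dominated_convergence
      (fun u => (1 + u ^ 2)⁻¹ * (g 0 + g 0)) (Eventually.of_forall fun x => ?_)
      (Eventually.of_forall fun x => ae_of_all _ fun u => ?_)
      (integrable_inv_one_add_sq.mul_const _) (ae_of_all _ fun u => ?_)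
    · have := (integrable_poisson_rescaled hdens hg hanti heven x).sub
        (integrable_poisson_rescaled hdens hg hanti heven (x + 1))
      refine this.aestronglyMeasurable.congr (ae_of_all _ fun u => ?_)
      simp only [Pi.sub_apply]
      ring
    · rw [norm_mul, Real.norm_of_nonneg (by positivity : (0 : ℝ) ≤ (1 + u ^ 2)⁻¹)]
      refine mul_le_mul_of_nonneg_left ((norm_sub_le _ _).trans ?_) (by positivity)
      exact add_le_add (abs_le_zero_value hdens hanti heven _)
        (abs_le_zero_value hdens hanti heven _)
    · have : Continuous fun x : ℝ => (1 + u ^ 2)⁻¹ * (g (x * u) - g ((x + 1) * u)) := by fun_prop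
      exact (this.tendsto 0).mono_left nhdsWithin_le_nhds
  have h3 : ∫ u, (1 + u ^ 2)⁻¹ * (g (0 * u) - g ((0 + 1) * u)) = x₀ g := by
    refine integral_congr_ae (ae_of_all _ fun u => ?_)
    simp [div_eq_inv_mul]
  rw [h3] at h2
  refine h2.congr' ?_
  filter_upwards [self_mem_nhdsWithin] with x hx
  exact (realG_eq_integral hdens hg hanti heven hx).symm

/-- In the right half-plane, the dispersion relation is the real equation `realG = 1 / K`. -/
lemma mul_Glap_eq_one_iff (hdens : IsDensity g) (hdecay : DecayAssumption g)
    (hanti : AntitoneOn g (Set.Ici 0)) (heven : ∀ ω, g (-ω) = g ω) {K : ℝ} {lam : ℂ}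
    (hlam : 0 < lam.re) :
    K * Glap g lam = 1 ↔ lam = (lam.re : ℂ) ∧ realG g lam.re = K⁻¹ := by
  constructor
  · intro h
    have hK : (K : ℂ) ≠ 0 := left_ne_zero_of_mul_eq_one h
    have h1 : Glap g lam = ((K⁻¹ : ℝ) : ℂ) := by
      rw [Complex.ofReal_inv]
      exact eq_inv_of_mul_eq_one_right h
    have h2 : lam.im = 0 := im_eq_zero_of_Glap_im_eq_zero hdens hdecay hanti heven hlam.le
      (by rw [h1, Complex.ofReal_im])
    have h3 : lam = (lam.re : ℂ) := Complex.ext (by simp) (by simp [h2])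
    refine ⟨h3, ?_⟩
    rw [h3, Glap_ofReal heven] at h1
    exact_mod_cast h1
  · rintro ⟨h1, h2⟩
    have hpos := realG_pos hdens hdecay hanti heven hlam.le
    -- With the convention 0⁻¹ = 0, the case K = 0 would ask for a zero of `realG`, which positivity
    -- excludes.
    have hK : K ≠ 0 := by
      rintro rfl
      rw [h2, inv_zero] at hpos
      exact lt_irrefl _ hpos
    rw [h1, Glap_ofReal heven, h2]
    rw [← Complex.ofReal_mul, mul_inv_cancel₀ hK, Complex.ofReal_one]

lemma exists_realG_eq_inv (hdens : IsDensity g) (hdecay : DecayAssumption g)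
    {K : ℝ} (hK0 : 0 < K)
    (hK : K⁻¹ < realG g 0) : ∃ x : ℝ, 0 < x ∧ realG g x = K⁻¹ := by
  obtain ⟨b, hb0, hb⟩ := ((eventually_ge_atTop (0 : ℝ)).and
    ((tendsto_realG_atTop hdens).eventually (gt_mem_nhds (inv_pos.2 hK0)))).exists
  obtain ⟨x, hx, hxK⟩ := intermediate_value_Icc' hb0
    ((continuousOn_realG hdens hdecay).mono Set.Icc_subset_Ici_self) ⟨hb.le, hK.le⟩
  refine ⟨x, lt_of_le_of_ne hx.1 ?_, hxK⟩
  rintro rfl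
  exact hK.ne' hxK

/-- The inverse branch of `realG = 1 / K` at the right of the critical coupling. -/
lemma exists_branch (hdens : IsDensity g) (hdecay : DecayAssumption g)
    (hanti : AntitoneOn g (Set.Ici 0)) (heven : ∀ ω, g (-ω) = g ω) {κ : ℝ} (hκ0 : 0 < κ)
    (hκ : realG g 0 = κ⁻¹) :
    ∃ ℓ : ℝ → ℝ, ℓ κ = 0 ∧ (∀ K, κ < K → 0 < ℓ K ∧ realG g (ℓ K) = K⁻¹) ∧
      Tendsto ℓ (𝓝[>] κ) (𝓝[>] 0) ∧
      ∃ s : ℝ, 0 < s ∧ HasDerivWithinAt ℓ s (Set.Ici κ) κ := by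
  have hs := strictAntiOn_realG hdens hdecay hanti heven
  -- Extending the branch by 0 to K ≤ κ supplies the value at κ needed for a one-sided derivative.
  have hex : ∀ K, ∃ x : ℝ, (K ≤ κ → x = 0) ∧ (κ < K → 0 < x ∧ realG g x = K⁻¹) := by
    intro K
    rcases le_or_gt K κ with h | h
    · exact ⟨0, fun _ => rfl, fun h' => absurd h' (not_lt.2 h)⟩
    · obtain ⟨x, hx⟩ := exists_realG_eq_inv hdens hdecay (hκ0.trans h)
        (by rw [hκ]; exact (inv_lt_inv₀ (hκ0.trans h) hκ0).2 h)
      exact ⟨x, fun h' => absurd h (not_lt.2 h'), fun _ => hx⟩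
  choose ℓ h0 h1 using hex
  have hinv : Tendsto (fun K : ℝ => K⁻¹) (𝓝[>] κ) (𝓝 κ⁻¹) :=
    (tendsto_inv₀ hκ0.ne').mono_left nhdsWithin_le_nhds
  have hlim : Tendsto ℓ (𝓝[>] κ) (𝓝[>] 0) := by
    refine tendsto_nhdsWithin_iff.2 ⟨?_, ?_⟩
    · refine tendsto_order.2 ⟨fun a ha => ?_, fun a ha => ?_⟩
      · filter_upwards [self_mem_nhdsWithin] with K hK
        exact ha.trans (h1 K hK).1
      · have h2 : realG g a < κ⁻¹ := by
          rw [← hκ]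
          exact hs Set.self_mem_Ici (le_of_lt ha) ha
        filter_upwards [self_mem_nhdsWithin, hinv.eventually (lt_mem_nhds h2)] with K hK hKa
        obtain ⟨e1, e2⟩ := h1 K hK
        rw [← e2] at hKa
        exact (hs.lt_iff_gt (show (0 : ℝ) ≤ a from le_of_lt ha) (show (0 : ℝ) ≤ ℓ K from e1.le)).1
          hKa
    · filter_upwards [self_mem_nhdsWithin] with K hK
      exact (h1 K hK).1
  have hm := moment_re_pos hdens hdecay hanti heven (le_refl (0 : ℝ))
  set J : ℝ := (laplace (fun s => s * source g (s, s)) (0 : ℝ)).re with hJ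
  -- The speed is 1/(κ² J), from differentiating `realG` (ℓ(K)) = 1/K at κ, where `realG` has
  -- derivative -J at 0.
  refine ⟨ℓ, h0 κ le_rfl, h1, hlim, (-J)⁻¹ * (-(κ ^ 2)⁻¹), ?_, ?_⟩
  · rw [inv_neg, neg_mul_neg]
    positivity
  · rw [hasDerivWithinAt_iff_tendsto_slope, Set.Ici_sdiff_left]
    have a1 : Tendsto (slope (realG g) 0) (𝓝[>] 0) (𝓝 (-J)) :=
      (hasDerivAt_iff_tendsto_slope.1 (hasDerivAt_realG hdens hdecay le_rfl)).mono_left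
        (nhdsWithin_mono 0 fun y (hy : y ∈ Set.Ioi (0 : ℝ)) => ne_of_gt hy)
    have a2 : Tendsto (slope (fun K : ℝ => K⁻¹) κ) (𝓝[>] κ) (𝓝 (-(κ ^ 2)⁻¹)) :=
      (hasDerivAt_iff_tendsto_slope.1 (hasDerivAt_inv hκ0.ne')).mono_left
        (nhdsWithin_mono κ fun y (hy : y ∈ Set.Ioi κ) => ne_of_gt hy)
    -- The slope of ℓ is the slope of K ↦ 1/K divided by that of `realG` between 0 and ℓ(K), so no
    -- inverse function theorem is needed at the endpoint.
    have a3 := ((a1.comp hlim).inv₀ (by linarith)).mul a2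
    refine a3.congr' ?_
    filter_upwards [self_mem_nhdsWithin] with K hK
    obtain ⟨e1, e2⟩ := h1 K hK
    have e3 : K⁻¹ - κ⁻¹ ≠ 0 := by
      rw [← e2, ← hκ]
      exact (sub_neg.2 (hs Set.self_mem_Ici (le_of_lt e1) e1)).ne
    simp only [Function.comp_apply, slope_def_field, e2, hκ, h0 κ le_rfl, sub_zero]
    rw [inv_div, div_mul_div_cancel₀ e3]

lemma eq_ofReal_of_isEigenvalue (hdens : IsDensity g) (hdecay : DecayAssumption g)
    (hanti : AntitoneOn g (Set.Ici 0)) (heven : ∀ ω, g (-ω) = g ω) {K : ℝ} {lam : ℂ}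
    (hlam : 0 < lam.re) (h : IsEigenvalue allToAll g K lam) {x : ℝ} (hx : 0 < x)
    (hxK : realG g x = K⁻¹) : lam = x := by
  obtain ⟨h1, h2⟩ := (mul_Glap_eq_one_iff hdens hdecay hanti heven hlam).1
    ((isEigenvalue_iff hdens hdecay.continuous_ghat hlam).1 h)
  rw [h1, (strictAntiOn_realG hdens hdecay hanti heven).injOn
    (show (0 : ℝ) ≤ lam.re from hlam.le) (show (0 : ℝ) ≤ x from hx.le) (h2.trans hxK.symm)]

lemma isSimpleEigenvalue_of_realG_eq (hdens : IsDensity g) (hdecay : DecayAssumption g)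
    (hanti : AntitoneOn g (Set.Ici 0)) (heven : ∀ ω, g (-ω) = g ω) {K x : ℝ} (hx : 0 < x)
    (hxK : realG g x = K⁻¹) : IsSimpleEigenvalue allToAll g K x := by
  have hre : 0 < (x : ℂ).re := by simpa using hx
  refine isSimpleEigenvalue_of_moment_ne_zero hdens hdecay.continuous_ghat hre
    ((mul_Glap_eq_one_iff hdens hdecay hanti heven hre).2 ⟨by simp, by simpa using hxK⟩) fun h => ?_
  have h1 := moment_re_pos hdens hdecay hanti heven hx.le
  rw [h] at h1
  exact lt_irrefl _ h1

/-- Positivity of `realG` rules out K ≤ 0, and for 0 < K < κ the value 1/K exceeds the maximum of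
`realG`, attained at 0. -/
lemma not_isEigenvalue_of_lt (hdens : IsDensity g) (hdecay : DecayAssumption g)
    (hanti : AntitoneOn g (Set.Ici 0)) (heven : ∀ ω, g (-ω) = g ω) {κ K : ℝ}
    (hκ : realG g 0 = κ⁻¹) (hK : K < κ) {lam : ℂ} (hlam : 0 < lam.re) :
    ¬ IsEigenvalue allToAll g K lam := by
  intro h
  obtain ⟨-, h2⟩ := (mul_Glap_eq_one_iff hdens hdecay hanti heven hlam).1
    ((isEigenvalue_iff hdens hdecay.continuous_ghat hlam).1 h)
  have h3 := realG_pos hdens hdecay hanti heven hlam.le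
  have h4 := strictAntiOn_realG hdens hdecay hanti heven Set.self_mem_Ici
    (show (0 : ℝ) ≤ lam.re from hlam.le) hlam
  rw [h2] at h3 h4
  rw [hκ] at h4
  have h5 : 0 < K := inv_pos.1 h3
  exact (inv_strictAnti₀ h5 hK).not_gt h4

lemma boundaryG_im_eq_zero (hdens : IsDensity g) (hdecay : DecayAssumption g)
    (hanti : AntitoneOn g (Set.Ici 0)) (heven : ∀ ω, g (-ω) = g ω) {t : ℝ}
    (h : (boundaryG g t).im = 0) : t = 0 := by
  rw [boundaryG_eq hdens hdecay] at h
  have := im_eq_zero_of_Glap_im_eq_zero hdens hdecay hanti heven (by simp) h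
  simpa using this

lemma hasDerivAt_boundaryG_zero (hdens : IsDensity g) (hdecay : DecayAssumption g) :
    HasDerivAt (boundaryG g)
      (-laplace (fun s => s * source g (s, s)) (0 : ℝ) * Complex.I) 0 := by
  rw [show boundaryG g = fun t : ℝ => Glap g (Complex.I * t) from
    funext (boundaryG_eq hdens hdecay)]
  have h1 : HasDerivAt (fun t : ℝ => Complex.I * (t : ℂ)) Complex.I 0 := by
    simpa using (hasDerivAt_id (0 : ℝ)).ofReal_comp.const_mul Complex.I
  refine HasDerivAt.comp (0 : ℝ) (h₂ := Glap g) ?_ h1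
  simpa using hasDerivAt_Glap hdens hdecay (lam := 0) (by simp)

end KuramotoInertia

end

/-! ### The stability threshold and the pitchfork bifurcation -/

open KuramotoInertia in
theorem mainTheorem1 (g : ℝ → ℝ) (hdens : IsDensity g) (heven : ∀ ω, g (-ω) = g ω)
    (huni : IsUnimodal g) (hdecay : DecayAssumption g) :
    -- the boundary values `G(it)` exist as limits
    (∀ t : ℝ, Tendsto (fun x : ℝ => G g (x + Complex.I * t)) (𝓝[>] 0) (𝓝 (boundaryG g t))) ∧
    -- the critical curve meets the positive real axis only at `x₀ = G(0) > 0`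
    0 < x₀ g ∧ boundaryG g 0 = (x₀ g : ℂ) ∧
    criticalCurve g ∩ {z : ℂ | 0 < z.re ∧ z.im = 0} = {(x₀ g : ℂ)} ∧
    -- no eigenvalue with positive real part for `K < K_c`
    (∀ K : ℝ, K < Kc g → ∀ lam : ℂ, 0 < lam.re → ¬ IsEigenvalue allToAll g K lam) ∧
    -- exactly one, which is simple and real, for `K > K_c`; it tends to `0` as `K → K_c+`
    (∃ ℓ : ℝ → ℝ,
      (∀ K : ℝ, Kc g < K → 0 < ℓ K ∧ IsSimpleEigenvalue allToAll g K (ℓ K) ∧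
        ∀ lam : ℂ, 0 < lam.re → IsEigenvalue allToAll g K lam → lam = ℓ K) ∧
      Tendsto ℓ (𝓝[>] (Kc g)) (𝓝[>] 0)) ∧
    -- mixing undergoes a pitchfork bifurcation at `K_c`
    IsPitchfork g (Kc g) := by
  have hanti := huni.antitoneOn_Ici heven
  have hzero := realG_zero hdens hdecay hanti heven
  have hx₀ : 0 < x₀ g := hzero ▸ realG_pos hdens hdecay hanti heven le_rfl
  have hb0 : boundaryG g 0 = (x₀ g : ℂ) := by
    rw [boundaryG_eq hdens hdecay, ← hzero, ← Glap_ofReal heven]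
    simp
  have hκ : realG g 0 = (Kc g)⁻¹ := by rw [Kc, inv_inv, hzero]
  obtain ⟨ℓ, hℓ0, hℓ, hlim, hder⟩ :=
    exists_branch hdens hdecay hanti heven (inv_pos.2 hx₀ : 0 < Kc g) hκ
  have hsup : ∀ K : ℝ, Kc g < K → 0 < ℓ K ∧ IsSimpleEigenvalue allToAll g K (ℓ K) ∧
      ∀ lam : ℂ, 0 < lam.re → IsEigenvalue allToAll g K lam → lam = ℓ K := fun K hK =>
    ⟨(hℓ K hK).1, isSimpleEigenvalue_of_realG_eq hdens hdecay hanti heven (hℓ K hK).1 (hℓ K hK).2,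
      fun lam hlam h => eq_ofReal_of_isEigenvalue hdens hdecay hanti heven hlam h
        (hℓ K hK).1 (hℓ K hK).2⟩
  have hsub : ∀ K : ℝ, K < Kc g → ∀ lam : ℂ, 0 < lam.re → ¬ IsEigenvalue allToAll g K lam :=
    fun K hK lam hlam => not_isEigenvalue_of_lt hdens hdecay hanti heven hκ hK hlam
  refine ⟨fun t => ?_, hx₀, hb0, ?_, hsub, ⟨ℓ, hsup, hlim⟩, ?_, ?_, ?_, ⟨ℓ, hℓ0, ?_, hder⟩⟩
  · rw [boundaryG_eq hdens hdecay]
    exact tendsto_G_boundary hdens hdecay t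
  · ext z
    simp only [criticalCurve, Set.mem_inter_iff, Set.mem_range, Set.mem_ofPred_eq,
      Set.mem_singleton_iff]
    constructor
    · rintro ⟨⟨t, rfl⟩, -, him⟩
      rw [boundaryG_im_eq_zero hdens hdecay hanti heven him, hb0]
    · rintro rfl
      exact ⟨⟨0, hb0⟩, by simpa using hx₀, Complex.ofReal_im _⟩
  · intro t
    rw [Kc, inv_inv]
    constructor
    · intro h
      exact boundaryG_im_eq_zero hdens hdecay hanti heven (by rw [h, Complex.ofReal_im])
    · rintro rfl
      exact hb0
  -- The derivative is -iJ with J the first moment at 0, so its imaginary part is -Re J < 0.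
  · refine ⟨_, ?_, hasDerivAt_boundaryG_zero hdens hdecay⟩
    have h := moment_re_pos hdens hdecay hanti heven (le_refl (0 : ℝ))
    rw [neg_mul, Complex.neg_im, Complex.mul_I_im]
    linarith
  · filter_upwards [self_mem_nhdsWithin] with K hK
    exact hsub K hK
  · filter_upwards [self_mem_nhdsWithin] with K hK
    exact hsup K hK
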